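/- **Proposition 1.10.** Let $(A_k : k<\omega)$ be a sequence of nonempty finite sets (in the ground model $V$). Let $\mathcal Q(\mathcal A)$ be the set of pairs $(T,K)$ where $T$ is a nonempty set of finite sequences closed under initial segments and $K:T\to\omega$, such that for all $\eta\in T$: (1) $\eta(l)\in A_l$ for all $l<\mathrm{len}(\eta)$; (2) for every $k\ge K(\eta)$ and every $x\in A_k$ there is $\rho\in T$ extending $\eta$ (possibly $\rho=\eta$), with $\mathrm{len}(\rho)>k$, such that $\rho(k)=x$. Order it by $(T,K)\le(T',K')$ iff $T'\subseteq T$, larger conditions being stronger. Then: 1. $\mathcal Q(\mathcal A)$ is nonempty and ${}^\omega\omega$-bounding: it forces that for every $f:\omega\to\omega$ in the generic extension there is $g:\omega\to\omega$ in $V$ with $f(n)\le g(n)$ for all $n$. 2. $\mathcal Q(\mathcal A)$ is proper. Here a preorder $P$ is proper if for every cardinal $\lambda$ with $\mathcal P(P)\in V_\lambda$ and every countable elementary substructure $M$ of $(V_\lambda;\in,P,\le)$ with $(P,\le)\in M$, every $p\in P\cap M$ has an extension $q\ge p$ that is $M$-generic, i.e. $q\Vdash\dot\alpha\in M$ for every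 $P$-name $\dot\alpha\in M$ of an ordinal. 3. There is a $\mathcal Q(\mathcal A)$-name $\dot\eta$ such that every condition forces: $\dot\eta\in\prod_k A_k$, and for all $f\in\prod_k A_k$ and all infinite $B\subseteq\omega$, both in $V$, the set $\{n\in B : \dot\eta(n)=f(n)\}$ is infinite. -/

import Mathlib

universe u v w

namespace SetForcing



/-! ## Names and the forcing relation

The ground model is the universe `ZFSet.{u}` of sets.  A forcing notion is a (small) preorder `P`;
`p ≤ q` means that `q` is the stronger condition. -/

/-- `P`-names: a name is a set-indexed family of pairs (name, condition). -/
inductive Name (P : Type v) : Type (max (u + 1) v)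
  | mk (ι : Type u) (name : ι → Name P) (cond : ι → P) : Name P

/-- The canonical name of a ground model set, given by a representative: the set of all pairs
`(check x, p)` with `x` an element and `p` any condition. -/
noncomputable def checkPSet (P : Type v) [Small.{u} P] : PSet.{u} → Name.{u} P
  | PSet.mk ι A =>
      Name.mk (ι × Shrink.{u} P) (fun i => checkPSet P (A i.1)) (fun i => (equivShrink P).symm i.2)

/-- The canonical name of a ground model set. -/
noncomputable def check (P : Type v) [Small.{u} P] (x : ZFSet.{u}) : Name.{u} P :=
  checkPSet P (Quotient.out x)

section Forces

variable {P : Type v} [Preorder P]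

/-- `p` forces `σ = τ`: below any condition stronger than `p` that puts an element into one of the
two names, it is dense to have an equal element of the other one. -/
def ForcesEq : Name.{u} P → Name.{u} P → P → Prop
  | Name.mk _ a s, Name.mk _ b t => fun p =>
      (∀ i, ∀ q, p ≤ q → s i ≤ q → ∃ r, q ≤ r ∧ ∃ j, t j ≤ r ∧ ForcesEq (a i) (b j) r) ∧
      (∀ j, ∀ q, p ≤ q → t j ≤ q → ∃ r, q ≤ r ∧ ∃ i, s i ≤ r ∧ ForcesEq (a i) (b j) r)

/-- `p` forces `σ ∈ τ`. -/
def ForcesMem (σ : Name.{u} P) : Name.{u} P → P → Prop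
  | Name.mk _ b t => fun p => ∀ q, p ≤ q → ∃ r, q ≤ r ∧ ∃ j, t j ≤ r ∧ ForcesEq σ (b j) r

end Forces

/-- Sentences of the forcing language: quantifiers range over all names. -/
inductive Sentence (P : Type v) : Type (max (u + 1) v)
  | mem (σ τ : Name.{u} P) : Sentence P
  | eq (σ τ : Name.{u} P) : Sentence P
  | neg (φ : Sentence P) : Sentence P
  | and (φ ψ : Sentence P) : Sentence P
  | or (φ ψ : Sentence P) : Sentence P
  | imp (φ ψ : Sentence P) : Sentence P
  | all (φ : Name.{u} P → Sentence P) : Sentence P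
  | ex (φ : Name.{u} P → Sentence P) : Sentence P

/-- The forcing relation `p ⊩ φ`, by the usual recursion on the sentence. -/
def Forces {P : Type v} [Preorder P] : Sentence.{u} P → P → Prop
  | .mem σ τ, p => ForcesMem σ τ p
  | .eq σ τ, p => ForcesEq σ τ p
  | .neg φ, p => ∀ q, p ≤ q → ¬ Forces φ q
  | .and φ ψ, p => Forces φ p ∧ Forces ψ p
  | .or φ ψ, p => ∀ q, p ≤ q → ∃ r, q ≤ r ∧ (Forces φ r ∨ Forces ψ r)
  | .imp φ ψ, p => ∀ q, p ≤ q → Forces φ q → Forces ψ q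
  | .all φ, p => ∀ σ, Forces (φ σ) p
  | .ex φ, p => ∀ q, p ≤ q → ∃ r, q ≤ r ∧ ∃ σ, Forces (φ σ) r

/-! ## Some set-theoretic notions, written in the forcing language -/

namespace Sentence

variable {P : Type v}

/-- `∀ x ∈ A, φ x` -/
def ballIn (A : Name.{u} P) (φ : Name.{u} P → Sentence.{u} P) : Sentence.{u} P :=
  all fun x => imp (mem x A) (φ x)

/-- `∃ x ∈ A, φ x` -/
def bexIn (A : Name.{u} P) (φ : Name.{u} P → Sentence.{u} P) : Sentence.{u} P :=
  ex fun x => and (mem x A) (φ x)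

/-- `z = {x, y}` -/
def isUPair (z x y : Name.{u} P) : Sentence.{u} P :=
  and (and (mem x z) (mem y z)) (ballIn z fun w => or (eq w x) (eq w y))

/-- `z = (x, y)`, the Kuratowski pair `{{x}, {x, y}}` -/
def isPair (z x y : Name.{u} P) : Sentence.{u} P :=
  ex fun a => ex fun b => and (and (isUPair a x x) (isUPair b x y)) (isUPair z a b)

/-- `(x, y) ∈ f` -/
def pairMem (x y f : Name.{u} P) : Sentence.{u} P :=
  bexIn f fun z => isPair z x y

/-- `f` is a function with domain `A` -/
def isFunOn (f A : Name.{u} P) : Sentence.{u} P :=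
  and (ballIn f fun z => bexIn A fun x => ex fun y => isPair z x y)
    (ballIn A fun x => and (ex fun y => pairMem x y f)
      (all fun y => all fun y' => imp (pairMem x y f) (imp (pairMem x y' f) (eq y y'))))

/-- `f` is a function from `A` to `B` -/
def isFunFromTo (f A B : Name.{u} P) : Sentence.{u} P :=
  and (isFunOn f A) (ballIn A fun x => all fun y => imp (pairMem x y f) (mem y B))

/-- `f` and `S` are functions with domain `D`, and `f x ∈ S x` for all `x ∈ D`; that is,
`f ∈ ∏_{x ∈ D} S x` -/
def isChoiceFun (f S D : Name.{u} P) : Sentence.{u} P :=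
  and (and (isFunOn f D) (isFunOn S D))
    (ballIn D fun x => all fun y => all fun a =>
      imp (pairMem x y f) (imp (pairMem x a S) (mem y a)))

/-- `f` and `g` take the same value at `x` -/
def agreeAt (f g x : Name.{u} P) : Sentence.{u} P :=
  ex fun y => and (pairMem x y f) (pairMem x y g)

/-- `α` is an ordinal: a transitive set of transitive sets -/
def isOrdinal (α : Name.{u} P) : Sentence.{u} P :=
  and (ballIn α fun x => ballIn x fun y => mem y α)
    (ballIn α fun x => ballIn x fun y => ballIn y fun z => mem z x)

end Sentence

/-! ## Proper forcing notions -/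

section Proper

/-- Symbols of the structure `(V_λ; ∈, P, ≤)`. -/
inductive PosetRel : ℕ → Type
  | mem : PosetRel 2
  | carrier : PosetRel 1
  | le : PosetRel 2

/-- The language of the structure `(V_λ; ∈, P, ≤)`. -/
def posetLanguage : FirstOrder.Language := ⟨fun _ => Empty, PosetRel⟩

variable {P : Type v} [Preorder P]

/-- The elements of `V_o`.  The map `e`, which encodes the conditions as sets, is a parameter
because the structure below depends on it. -/
def Vset (_e : P → ZFSet.{u}) (o : Ordinal.{u}) : Type (u + 1) :=
  {x : ZFSet.{u} // x ∈ ZFSet.vonNeumann o}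

/-- The structure `(V_o; ∈, P, ≤)`. -/
instance instVset (e : P → ZFSet.{u}) (o : Ordinal.{u}) : posetLanguage.Structure (Vset e o) where
  funMap := fun f _ => Empty.elim f
  RelMap := fun r => match r with
    | PosetRel.mem => fun x => (x 0).1 ∈ (x 1).1
    | PosetRel.carrier => fun x => ∃ p, e p = (x 0).1
    | PosetRel.le => fun x => ∃ p q, p ≤ q ∧ e p = (x 0).1 ∧ e q = (x 1).1

/-- The set of (codes of) conditions. -/
noncomputable def carrierSet [Small.{u} P] (e : P → ZFSet.{u}) : ZFSet.{u} := ZFSet.range e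

/-- The order of the forcing notion as a set of pairs. -/
noncomputable def orderSet [Small.{u} P] (e : P → ZFSet.{u}) : ZFSet.{u} :=
  ZFSet.range fun x : {x : P × P // x.1 ≤ x.2} => ZFSet.pair (e x.1.1) (e x.1.2)

/-- A name as a set: the set of all pairs (name, condition) that it consists of. -/
noncomputable def nameSet (e : P → ZFSet.{u}) : Name.{u} P → ZFSet.{u}
  | Name.mk _ a s => ZFSet.range fun i => ZFSet.pair (nameSet e (a i)) (e (s i))

/-- The underlying set of a substructure of `V_o`. -/
noncomputable def modelSet {e : P → ZFSet.{u}} {o : Ordinal.{u}}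
    (M : posetLanguage.ElementarySubstructure (Vset e o)) : ZFSet.{u} :=
  ZFSet.sep (fun x => ∃ y ∈ M, y.1 = x) (ZFSet.vonNeumann o)

/-- `q` is `M`-generic: for every name `α ∈ M` of an ordinal, `q ⊩ α ∈ M`. -/
def IsGenericCondition [Small.{u} P] {e : P → ZFSet.{u}} {o : Ordinal.{u}}
    (M : posetLanguage.ElementarySubstructure (Vset e o)) (q : P) : Prop :=
  ∀ α : Name.{u} P, nameSet e α ∈ modelSet M → (∀ p : P, Forces (.isOrdinal α) p) →
    Forces (.mem α (check P (modelSet M))) q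

end Proper

/-- `P` is proper: for every cardinal `λ` such that the power set of `P` is in `V_λ`, and every
countable elementary substructure `M` of `(V_λ; ∈, P, ≤)` that contains the forcing notion, every
condition in `M` has an `M`-generic extension.  As the members of the type `P` need not be sets,
this is required of every copy of `P` in the universe of sets. -/
def IsProper (P : Type v) [Preorder P] [Small.{u} P] : Prop :=
  ∀ e : P → ZFSet.{u}, Function.Injective e →
  ∀ c : Cardinal.{u}, (carrierSet e).powerset ∈ ZFSet.vonNeumann c.ord →
  ∀ M : posetLanguage.ElementarySubstructure (Vset e c.ord), (M : Set (Vset e c.ord)).Countable →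
    ZFSet.pair (carrierSet e) (orderSet e) ∈ modelSet M →
  ∀ p : P, e p ∈ modelSet M → ∃ q : P, p ≤ q ∧ IsGenericCondition M q

/-! ## `ω^ω`-bounding forcing notions -/

/-- `P` is `ω^ω`-bounding: it forces that every function from `ω` to `ω` is bounded everywhere by
one in the ground model. -/
def IsOmegaOmegaBounding (P : Type v) [Preorder P] [Small.{u} P] : Prop :=
  ∀ p : P, Forces
    (.all fun f => .imp (.isFunFromTo f (check P ZFSet.omega.{u}) (check P ZFSet.omega.{u}))
      (.bexIn (check P (ZFSet.funs ZFSet.omega.{u} ZFSet.omega.{u})) fun g =>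
        .ballIn (check P ZFSet.omega.{u}) fun n => .all fun a => .all fun b =>
          .imp (.pairMem n a f) (.imp (.pairMem n b g) (.or (.mem a b) (.eq a b))))) p

/-! ## The tree forcing -/

/-- A condition of the tree forcing: a pair `(T, K)`, where `T` is a (nonempty) tree of finite
sequences and `K : T → ω`. Sequences are lists; `η <+: ρ` says that `ρ` extends `η`. -/
structure TreeForcing {X : Type w} (A : ℕ → Set X) : Type w where
  T : Set (List X)
  K : T → ℕ
  nonempty : T.Nonempty
  prefix_closed : ∀ ρ ∈ T, ∀ η, η <+: ρ → η ∈ T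
  mem_A : ∀ η ∈ T, ∀ (l : ℕ) (hl : l < η.length), η[l] ∈ A l
  exists_ext : ∀ η : T, ∀ k, K η ≤ k → ∀ x ∈ A k, ∃ ρ ∈ T, η.1 <+: ρ ∧ ρ[k]? = some x

/-- `(T, K) ≤ (T', K')` if and only if `T'` is a subtree of `T`. -/
instance {X : Type w} (A : ℕ → Set X) : Preorder (TreeForcing A) where
  le p q := q.T ⊆ p.T
  le_refl p := subset_refl p.T
  le_trans _ _ _ hpq hqr := hqr.trans hpq

/-- The tree forcing `Q(A)` of a sequence of sets. -/
abbrev Q (A : ℕ → ZFSet.{u}) : Type (u + 1) := TreeForcing fun k => (A k : Set ZFSet.{u})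

instance (A : ℕ → ZFSet.{u}) : Small.{u} (Q A) := by
  let U : ZFSet.{u} := ZFSet.iUnion A
  have key : ∀ (p : Q A), p.T ⊆ Set.range (List.map (Subtype.val : U → ZFSet.{u})) := by
    intro p η hη
    rw [Set.range_list_map]
    intro x hx
    obtain ⟨l, hl, rfl⟩ := List.getElem_of_mem hx
    exact ⟨⟨_, ZFSet.mem_iUnion.2 ⟨l, p.mem_A η hη l hl⟩⟩, rfl⟩
  let F : Q A → Set (List U × ℕ) := fun p =>
    {z | ∃ h : z.1.map Subtype.val ∈ p.T, p.K ⟨_, h⟩ = z.2}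
  refine small_of_injective (f := F) ?_
  intro p q hpq
  have sub : ∀ p q : Q A, F p = F q → ∀ η (h : η ∈ p.T), ∃ h' : η ∈ q.T, q.K ⟨η, h'⟩ = p.K ⟨η, h⟩ := by
    intro p q hpq η h
    obtain ⟨ζ, rfl⟩ := key p h
    have : (ζ, p.K ⟨_, h⟩) ∈ F p := ⟨h, rfl⟩
    rw [hpq] at this
    exact this
  have hT : p.T = q.T := Set.ext fun η =>
    ⟨fun h => (sub p q hpq η h).1, fun h => (sub q p hpq.symm η h).1⟩
  have hK := sub p q hpq
  obtain ⟨T, K, _, _, _, _⟩ := p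
  obtain ⟨T', K', _, _, _, _⟩ := q
  obtain rfl : T = T' := hT
  obtain rfl : K = K' := funext fun η => ((hK η.1 η.2).2).symm
  rfl

/-! ## Ground model sequences as sets -/

/-- The natural number `n` as a von Neumann ordinal. -/
def natSet (n : ℕ) : ZFSet.{u} := ZFSet.mk (PSet.ofNat n)

/-- The sequence `(f n : n < ω)` as a set of pairs. -/
noncomputable def seqSet (f : ℕ → ZFSet.{u}) : ZFSet.{u} :=
  ZFSet.range fun n : ℕ => ZFSet.pair (natSet n) (f n)

/-- A set of natural numbers as a subset of `ω`. -/
noncomputable def subsetOmega (B : Set ℕ) : ZFSet.{u} :=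
  ZFSet.range fun n : B => natSet n.1

/-- In the forcing language: `f` and `g` agree on an infinite subset of the subset `B` of `ω`
(for every `m ∈ ω` there is `n ∈ B` with `m < n` and `f n = g n`). -/
noncomputable def agreeInfinitely {P : Type v} [Small.{u} P] (f g B : Name.{u} P) :
    Sentence.{u} P :=
  .ballIn (check P ZFSet.omega.{u}) fun m => .bexIn B fun n => .and (.mem m n) (.agreeAt f g n)

end SetForcing

/-! The first two claims are a fusion argument. The order ignores K, so the level K(∅) of the root
can be raised at will and serve as a counter. In a fusion step from p to q (`TreeForcing.FusionRel`)
the nonempty nodes of length at most K_p(∅) survive with their levels unchanged, while K(∅) strictly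
increases. Chains of such steps are bounded (`TreeForcing.FusionRel.exists_bound`): if the counters
are unbounded, the intersection of the trees is again a condition, because witnesses can be cut
short and are then frozen from some stage on.

A step also reduces a dense set D to a finite subset (`TreeForcing.FusionRel.exists_step`). As the
A_k are finite, p has finitely many nodes η of length at most K_p(∅). Choose r_η ∈ D inside p with η
in its tree. From its own level on, r_η supplies all values above η; only finitely many coordinates
between the two levels remain, and for each value there a witness node of p is added, together with
a condition of D through it. The union of these finitely many trees is the new tree. The conditions
used are predense above it (`TreeForcing.predenseAbove_of_subset`), since a stronger tree cannot
leave all of finitely many trees one after another.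

`IsFusion` isolates what is needed. Bounding follows by leaving finitely many possible values for
each f(n). For properness, being a fusion relation is first-order over V_λ, so M contains such a
relation, and the fusion can be run with steps in M. Each name of an ordinal in M is decided by
every member of a finite predense set in M; the members lie in M, and so do values that they decide.
This needs a first-order form of "r forces α = x" (`ValueV`) and the fact that names of ordinals
take ground model values (`exists_forcesEq_check_toZFSet`).

For the third claim, beyond K(∅) every value occurs at every coordinate, so some n ∈ B has a node
with value f(n) at n; the subtree comparable with that node decides η(n) = f(n). -/

namespace SetForcing

/-! ### Equality, membership, monotonicity and density for the forcing relation -/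

section Basic

variable {P : Type v} [Preorder P]

theorem forcesEq_mk {ι κ : Type u} {a : ι → Name.{u} P} {s : ι → P} {b : κ → Name.{u} P}
    {t : κ → P} {p : P} : ForcesEq (Name.mk ι a s) (Name.mk κ b t) p ↔
      (∀ i, ∀ q, p ≤ q → s i ≤ q → ∃ r, q ≤ r ∧ ∃ j, t j ≤ r ∧ ForcesEq (a i) (b j) r) ∧
      (∀ j, ∀ q, p ≤ q → t j ≤ q → ∃ r, q ≤ r ∧ ∃ i, s i ≤ r ∧ ForcesEq (a i) (b j) r) := by
  rw [ForcesEq]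

theorem forcesMem_mk {κ : Type u} {σ : Name.{u} P} {b : κ → Name.{u} P}
    {t : κ → P} {p : P} : ForcesMem σ (Name.mk κ b t) p ↔
      ∀ q, p ≤ q → ∃ r, q ≤ r ∧ ∃ j, t j ≤ r ∧ ForcesEq σ (b j) r := by
  rw [ForcesMem]

theorem ForcesEq.mono {σ τ : Name.{u} P} {p q : P} (h : ForcesEq σ τ p) (hpq : p ≤ q) :
    ForcesEq σ τ q := by
  cases σ; cases τ
  rw [forcesEq_mk] at h ⊢
  exact ⟨fun i r hr => h.1 i r (hpq.trans hr), fun j r hr => h.2 j r (hpq.trans hr)⟩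

theorem ForcesEq.of_dense {σ τ : Name.{u} P} {p : P}
    (h : ∀ q, p ≤ q → ∃ r, q ≤ r ∧ ForcesEq σ τ r) : ForcesEq σ τ p := by
  cases σ; cases τ
  rw [forcesEq_mk]
  constructor
  · intro i q hq hi
    obtain ⟨r, hr, h'⟩ := h q hq
    rw [forcesEq_mk] at h'
    obtain ⟨r', hr', x⟩ := h'.1 i r le_rfl (hi.trans hr)
    exact ⟨r', hr.trans hr', x⟩
  · intro i q hq hi
    obtain ⟨r, hr, h'⟩ := h q hq
    rw [forcesEq_mk] at h'
    obtain ⟨r', hr', x⟩ := h'.2 i r le_rfl (hi.trans hr)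
    exact ⟨r', hr.trans hr', x⟩

theorem ForcesEq.refl (σ : Name.{u} P) (p : P) : ForcesEq σ σ p := by
  induction σ generalizing p with
  | mk ι a s ih =>
    rw [forcesEq_mk]
    exact ⟨fun i q _ hi => ⟨q, le_rfl, i, hi, ih i q⟩, fun i q _ hi => ⟨q, le_rfl, i, hi, ih i q⟩⟩

theorem ForcesEq.symm {σ τ : Name.{u} P} {p : P} (h : ForcesEq σ τ p) : ForcesEq τ σ p := by
  induction σ generalizing τ p with
  | mk ι a s ih =>
    cases τ
    rw [forcesEq_mk] at h ⊢
    constructor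
    · intro j q hq hj
      obtain ⟨r, hr, i, hi, e⟩ := h.2 j q hq hj
      exact ⟨r, hr, i, hi, ih i e⟩
    · intro j q hq hj
      obtain ⟨r, hr, i, hi, e⟩ := h.1 j q hq hj
      exact ⟨r, hr, i, hi, ih _ e⟩

theorem ForcesEq.trans {σ τ ρ : Name.{u} P} {p : P} (h : ForcesEq σ τ p) (h' : ForcesEq τ ρ p) :
    ForcesEq σ ρ p := by
  induction σ generalizing τ ρ p with
  | mk ι a s ih =>
    cases τ; cases ρ
    rw [forcesEq_mk] at h h' ⊢
    constructor
    · intro i q hq hi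
      obtain ⟨r, hr, j, hj, e⟩ := h.1 i q hq hi
      obtain ⟨r', hr', k, hk, e'⟩ := h'.1 j r (hq.trans hr) hj
      exact ⟨r', hr.trans hr', k, hk, ih i (e.mono hr') e'⟩
    · intro i q hq hi
      obtain ⟨r, hr, j, hj, e⟩ := h'.2 i q hq hi
      obtain ⟨r', hr', k, hk, e'⟩ := h.2 j r (hq.trans hr) hj
      exact ⟨r', hr.trans hr', k, hk, ih k e' (e.mono hr')⟩

theorem ForcesMem.mono {σ τ : Name.{u} P} {p q : P} (h : ForcesMem σ τ p) (hpq : p ≤ q) :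
    ForcesMem σ τ q := by
  cases τ
  rw [forcesMem_mk] at h ⊢
  exact fun r hr => h r (hpq.trans hr)

theorem ForcesMem.of_dense {σ τ : Name.{u} P} {p : P}
    (h : ∀ q, p ≤ q → ∃ r, q ≤ r ∧ ForcesMem σ τ r) : ForcesMem σ τ p := by
  cases τ
  rw [forcesMem_mk]
  intro q hq
  obtain ⟨r, hr, h'⟩ := h q hq
  rw [forcesMem_mk] at h'
  obtain ⟨r', hr', x⟩ := h' r le_rfl
  exact ⟨r', hr.trans hr', x⟩

theorem ForcesMem.congr_left {σ σ' τ : Name.{u} P} {p : P} (h : ForcesMem σ τ p)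
    (e : ForcesEq σ σ' p) : ForcesMem σ' τ p := by
  cases τ
  rw [forcesMem_mk] at h ⊢
  intro q hq
  obtain ⟨r, hr, j, hj, e'⟩ := h q hq
  exact ⟨r, hr, j, hj, (e.mono (hq.trans hr)).symm.trans e'⟩

theorem ForcesMem.congr_right {σ τ τ' : Name.{u} P} {p : P} (h : ForcesMem σ τ p)
    (e : ForcesEq τ τ' p) : ForcesMem σ τ' p := by
  cases τ; cases τ'
  rw [forcesEq_mk] at e
  rw [forcesMem_mk] at h ⊢
  intro q hq
  obtain ⟨r, hr, j, hj, e'⟩ := h q hq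
  obtain ⟨r', hr', k, hk, e''⟩ := e.1 j r (hq.trans hr) hj
  exact ⟨r', hr.trans hr', k, hk, (e'.mono hr').trans e''⟩

theorem forcesMem_mk_self {κ : Type u} (b : κ → Name.{u} P) (t : κ → P) {j : κ} {p : P}
    (h : t j ≤ p) : ForcesMem (b j) (Name.mk κ b t) p := by
  rw [forcesMem_mk]
  exact fun q hq => ⟨q, le_rfl, j, h.trans hq, ForcesEq.refl _ _⟩

/-- Extensionality for the forcing relation. -/
theorem ForcesEq.ext {σ τ : Name.{u} P} {p : P}
    (h : ∀ ρ q, p ≤ q → ForcesMem ρ σ q → ForcesMem ρ τ q)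
    (h' : ∀ ρ q, p ≤ q → ForcesMem ρ τ q → ForcesMem ρ σ q) : ForcesEq σ τ p := by
  obtain ⟨ι, a, s⟩ := σ
  obtain ⟨κ, b, t⟩ := τ
  rw [forcesEq_mk]
  constructor
  · intro i q hq hi
    exact forcesMem_mk.1 (h _ q hq (forcesMem_mk_self a s hi)) q le_rfl
  · intro j q hq hj
    obtain ⟨r, hr, i, hi, e⟩ := forcesMem_mk.1 (h' _ q hq (forcesMem_mk_self b t hj)) q le_rfl
    exact ⟨r, hr, i, hi, e.symm⟩

theorem Forces.mono {φ : Sentence.{u} P} {p q : P} (h : Forces φ p) (hpq : p ≤ q) :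
    Forces φ q := by
  induction φ generalizing p q with
  | mem σ τ => exact ForcesMem.mono h hpq
  | eq σ τ => exact ForcesEq.mono h hpq
  | neg φ _ => exact fun r hr => h r (hpq.trans hr)
  | and φ ψ ih ih' => exact ⟨ih h.1 hpq, ih' h.2 hpq⟩
  | or φ ψ _ _ => exact fun r hr => h r (hpq.trans hr)
  | imp φ ψ _ _ => exact fun r hr => h r (hpq.trans hr)
  | all φ ih => exact fun σ => ih σ (h σ) hpq
  | ex φ _ => exact fun r hr => h r (hpq.trans hr)

theorem Forces.of_dense {φ : Sentence.{u} P} {p : P}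
    (h : ∀ q, p ≤ q → ∃ r, q ≤ r ∧ Forces φ r) : Forces φ p := by
  induction φ generalizing p with
  | mem σ τ => exact ForcesMem.of_dense h
  | eq σ τ => exact ForcesEq.of_dense h
  | neg φ _ =>
    intro q hq hφ
    obtain ⟨r, hr, h'⟩ := h q hq
    exact h' r le_rfl (hφ.mono hr)
  | and φ ψ ih ih' =>
    exact ⟨ih fun q hq => (h q hq).imp fun r hr => ⟨hr.1, hr.2.1⟩,
      ih' fun q hq => (h q hq).imp fun r hr => ⟨hr.1, hr.2.2⟩⟩
  | or φ ψ _ _ =>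
    intro q hq
    obtain ⟨r, hr, h'⟩ := h q hq
    obtain ⟨r', hr', h''⟩ := h' r le_rfl
    exact ⟨r', hr.trans hr', h''⟩
  | imp φ ψ _ ih =>
    intro q hq hφ
    refine ih fun q' hq' => ?_
    obtain ⟨r, hr, h'⟩ := h q' (hq.trans hq')
    exact ⟨r, hr, h' r le_rfl (hφ.mono (hq'.trans hr))⟩
  | all φ ih =>
    exact fun σ => ih σ fun q hq => (h q hq).imp fun r hr => ⟨hr.1, hr.2 σ⟩
  | ex φ _ =>
    intro q hq
    obtain ⟨r, hr, h'⟩ := h q hq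
    obtain ⟨r', hr', h''⟩ := h' r le_rfl
    exact ⟨r', hr.trans hr', h''⟩

theorem forces_ex_of {φ : Name.{u} P → Sentence.{u} P} {p : P} (σ : Name.{u} P)
    (h : Forces (φ σ) p) : Forces (.ex φ) p :=
  fun q hq => ⟨q, le_rfl, σ, h.mono hq⟩

end Basic

/-! ### Canonical names and names of pairs -/

section Check

variable {P : Type v} [Preorder P] [Small.{u} P]

theorem checkPSet_congr {x y : PSet.{u}} (h : PSet.Equiv x y) (p : P) :
    ForcesEq (checkPSet P x) (checkPSet P y) p := by
  induction x generalizing y p with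
  | mk ι A ih =>
    obtain ⟨κ, B⟩ := y
    rw [checkPSet, checkPSet, forcesEq_mk]
    constructor
    · rintro ⟨i, c⟩ q hq hi
      obtain ⟨j, hj⟩ := h.1 i
      exact ⟨q, le_rfl, ⟨j, c⟩, hi, ih i hj q⟩
    · rintro ⟨j, c⟩ q hq hj
      obtain ⟨i, hi⟩ := h.2 j
      exact ⟨q, le_rfl, ⟨i, c⟩, hj, ih i hi q⟩

/-- A single condition suffices: each element of one set is matched, at a stronger condition, with
an equal element of the other, and induction makes the match true in the ground model. -/
theorem checkPSet_injective {x y : PSet.{u}} {p : P}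
    (h : ForcesEq (checkPSet P x) (checkPSet P y) p) : PSet.Equiv x y := by
  induction x generalizing y p with
  | mk ι A ih =>
    obtain ⟨κ, B⟩ := y
    rw [checkPSet, checkPSet, forcesEq_mk] at h
    constructor
    · intro i
      obtain ⟨r, hr, ⟨j, c⟩, -, e⟩ := h.1 ⟨i, equivShrink P p⟩ p le_rfl (by simp)
      exact ⟨j, ih i e⟩
    · intro j
      obtain ⟨r, hr, ⟨i, c⟩, -, e⟩ := h.2 ⟨j, equivShrink P p⟩ p le_rfl (by simp)
      exact ⟨i, ih i e⟩

theorem checkPSet_eq_check (x : PSet.{u}) (p : P) :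
    ForcesEq (checkPSet P x) (check P (ZFSet.mk x)) p :=
  checkPSet_congr (PSet.Equiv.symm (ZFSet.exact (Quotient.out_eq (ZFSet.mk x)))) p

theorem forcesEq_check_iff {x y : ZFSet.{u}} {p : P} :
    ForcesEq (check P x) (check P y) p ↔ x = y := by
  constructor
  · intro h
    have := ZFSet.sound (checkPSet_injective h)
    rwa [show ZFSet.mk (Quotient.out x) = x from Quotient.out_eq x,
      show ZFSet.mk (Quotient.out y) = y from Quotient.out_eq y] at this
  · rintro rfl
    exact ForcesEq.refl _ _

theorem forcesMem_checkPSet_iff {σ : Name.{u} P} {x : PSet.{u}} {p : P} :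
    ForcesMem σ (checkPSet P x) p ↔
      ∀ q, p ≤ q → ∃ r, q ≤ r ∧ ∃ y ∈ ZFSet.mk x, ForcesEq σ (check P y) r := by
  obtain ⟨ι, A⟩ := x
  rw [checkPSet, forcesMem_mk]
  refine forall₂_congr fun q _ => exists_congr fun r => and_congr_right fun _ => ?_
  constructor
  · rintro ⟨⟨i, c⟩, hc, e⟩
    exact ⟨ZFSet.mk (A i), PSet.Mem.mk A i, e.trans (checkPSet_eq_check _ _)⟩
  · rintro ⟨y, hy, e⟩
    induction y using Quotient.inductionOn with
    | h y =>
    obtain ⟨i, hi⟩ : y ∈ PSet.mk ι A := hy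
    refine ⟨⟨i, equivShrink P r⟩, by simp, ?_⟩
    exact e.trans ((checkPSet_eq_check y r).symm.trans (checkPSet_congr hi r))

theorem forcesMem_check_iff {σ : Name.{u} P} {x : ZFSet.{u}} {p : P} :
    ForcesMem σ (check P x) p ↔
      ∀ q, p ≤ q → ∃ r, q ≤ r ∧ ∃ y ∈ x, ForcesEq σ (check P y) r := by
  rw [check, forcesMem_checkPSet_iff, show ZFSet.mk (Quotient.out x) = x from Quotient.out_eq x]

theorem forcesMem_check_of {σ : Name.{u} P} {x y : ZFSet.{u}} {p : P} (hy : y ∈ x)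
    (h : ForcesEq σ (check P y) p) : ForcesMem σ (check P x) p :=
  forcesMem_check_iff.2 fun q hq => ⟨q, le_rfl, y, hy, h.mono hq⟩

theorem forcesMem_check_check_iff {x y : ZFSet.{u}} {p : P} :
    ForcesMem (check P x) (check P y) p ↔ x ∈ y := by
  constructor
  · intro h
    obtain ⟨r, -, z, hz, e⟩ := forcesMem_check_iff.1 h p le_rfl
    rwa [forcesEq_check_iff.1 e]
  · intro h
    exact forcesMem_check_of h (ForcesEq.refl _ _)

/-- A name for the unordered pair. -/
noncomputable def upairName (x y : Name.{u} P) : Name.{u} P :=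
  Name.mk (ULift.{u} Bool × Shrink.{u} P) (fun i => if i.1.down then x else y)
    (fun i => (equivShrink P).symm i.2)

theorem forcesMem_upairName_iff {z x y : Name.{u} P} {p : P} :
    ForcesMem z (upairName x y) p ↔
      ∀ q, p ≤ q → ∃ r, q ≤ r ∧ (ForcesEq z x r ∨ ForcesEq z y r) := by
  rw [upairName, forcesMem_mk]
  refine forall₂_congr fun q _ => exists_congr fun r => and_congr_right fun _ => ?_
  constructor
  · rintro ⟨⟨⟨_ | _⟩, c⟩, hc, e⟩
    · exact Or.inr (by simpa using e)
    · exact Or.inl (by simpa using e)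
  · rintro (e | e)
    · exact ⟨⟨⟨true⟩, equivShrink P r⟩, by simp, by simpa using e⟩
    · exact ⟨⟨⟨false⟩, equivShrink P r⟩, by simp, by simpa using e⟩

theorem forcesMem_upairName_left (x y : Name.{u} P) (p : P) : ForcesMem x (upairName x y) p :=
  forcesMem_upairName_iff.2 fun q _ => ⟨q, le_rfl, Or.inl (ForcesEq.refl _ _)⟩

theorem forcesMem_upairName_right (x y : Name.{u} P) (p : P) : ForcesMem y (upairName x y) p :=
  forcesMem_upairName_iff.2 fun q _ => ⟨q, le_rfl, Or.inr (ForcesEq.refl _ _)⟩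

theorem forces_isUPair_iff {z x y : Name.{u} P} {p : P} :
    Forces (.isUPair z x y) p ↔ ForcesEq z (upairName x y) p := by
  constructor
  · rintro ⟨⟨hx, hy⟩, h⟩
    refine ForcesEq.ext (fun ρ q hq hρ => ?_) (fun ρ q hq hρ => ?_)
    · exact forcesMem_upairName_iff.2 (h ρ q hq hρ)
    · refine ForcesMem.of_dense fun q' hq' => ?_
      obtain ⟨r, hr, e | e⟩ := forcesMem_upairName_iff.1 hρ q' hq'
      · exact ⟨r, hr, (ForcesMem.mono hx (hq.trans (hq'.trans hr))).congr_left e.symm⟩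
      · exact ⟨r, hr, (ForcesMem.mono hy (hq.trans (hq'.trans hr))).congr_left e.symm⟩
  · intro e
    refine ⟨⟨(forcesMem_upairName_left x y p).congr_right e.symm,
      (forcesMem_upairName_right x y p).congr_right e.symm⟩, fun w q hq hw => ?_⟩
    exact forcesMem_upairName_iff.1 (ForcesMem.congr_right hw (e.mono hq))

theorem upairName_congr {x y x' y' : Name.{u} P} {p : P} (hx : ForcesEq x x' p)
    (hy : ForcesEq y y' p) : ForcesEq (upairName x y) (upairName x' y') p := by
  rw [← forces_isUPair_iff]
  refine ⟨⟨(forcesMem_upairName_left x y p).congr_left hx,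
    (forcesMem_upairName_right x y p).congr_left hy⟩, fun w q hq hw q' hq' => ?_⟩
  obtain ⟨r, hr, e⟩ := forcesMem_upairName_iff.1 hw q' hq'
  exact ⟨r, hr, e.imp (fun e => e.trans (hx.mono (hq.trans (hq'.trans hr))))
    fun e => e.trans (hy.mono (hq.trans (hq'.trans hr)))⟩

theorem upairName_inj_left {x x' y' : Name.{u} P} {p : P}
    (h : ForcesEq (upairName x x) (upairName x' y') p) : ForcesEq x x' p ∧ ForcesEq x y' p := by
  constructor
  · refine ForcesEq.of_dense fun q hq => ?_
    obtain ⟨r, hr, e⟩ := forcesMem_upairName_iff.1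
      ((forcesMem_upairName_left x' y' p).congr_right h.symm) q hq
    exact ⟨r, hr, (or_self_iff.1 e).symm⟩
  · refine ForcesEq.of_dense fun q hq => ?_
    obtain ⟨r, hr, e⟩ := forcesMem_upairName_iff.1
      ((forcesMem_upairName_right x' y' p).congr_right h.symm) q hq
    exact ⟨r, hr, (or_self_iff.1 e).symm⟩

theorem upairName_inj_right {x y y' : Name.{u} P} {p : P}
    (h : ForcesEq (upairName x y) (upairName x y') p) : ForcesEq y y' p := by
  refine ForcesEq.of_dense fun q hq => ?_
  obtain ⟨r, hr, e | e⟩ := forcesMem_upairName_iff.1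
    ((forcesMem_upairName_right x y p).congr_right h) q hq
  · obtain ⟨r', hr', e' | e'⟩ := forcesMem_upairName_iff.1
      ((forcesMem_upairName_right x y' p).congr_right h.symm) r (hq.trans hr)
    · exact ⟨r', hr.trans hr', (e.mono hr').trans e'.symm⟩
    · exact ⟨r', hr.trans hr', e'.symm⟩
  · exact ⟨r, hr, e⟩

/-- A name for the ordered pair. -/
noncomputable def pairName (x y : Name.{u} P) : Name.{u} P :=
  upairName (upairName x x) (upairName x y)

theorem pairName_congr {x y x' y' : Name.{u} P} {p : P} (hx : ForcesEq x x' p)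
    (hy : ForcesEq y y' p) : ForcesEq (pairName x y) (pairName x' y') p :=
  upairName_congr (upairName_congr hx hx) (upairName_congr hx hy)

/-- Removes the existential quantifiers from the pair formula; from here on, statements about pairs
are computations with `ForcesEq`. -/
theorem forces_isPair_iff {z x y : Name.{u} P} {p : P} :
    Forces (.isPair z x y) p ↔ ForcesEq z (pairName x y) p := by
  constructor
  · intro h
    refine ForcesEq.of_dense fun q hq => ?_
    obtain ⟨r, hr, a, h'⟩ := h q hq
    obtain ⟨r', hr', b, ⟨ha, hb⟩, hz⟩ := h' r le_rfl
    rw [forces_isUPair_iff] at ha hb hz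
    exact ⟨r', hr.trans hr', hz.trans (upairName_congr ha hb)⟩
  · intro h
    refine forces_ex_of (upairName x x) (forces_ex_of (upairName x y) ⟨⟨?_, ?_⟩, ?_⟩)
    · exact forces_isUPair_iff.2 (ForcesEq.refl _ _)
    · exact forces_isUPair_iff.2 (ForcesEq.refl _ _)
    · exact forces_isUPair_iff.2 h

theorem pairName_inj {x y x' y' : Name.{u} P} {p : P}
    (h : ForcesEq (pairName x y) (pairName x' y') p) : ForcesEq x x' p ∧ ForcesEq y y' p := by
  have hx : ForcesEq x x' p := by
    refine ForcesEq.of_dense fun q hq => ?_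
    obtain ⟨r, hr, e | e⟩ := forcesMem_upairName_iff.1
      ((forcesMem_upairName_left (upairName x x) (upairName x y) p).congr_right h) q hq
    · exact ⟨r, hr, (upairName_inj_left e).1⟩
    · exact ⟨r, hr, (upairName_inj_left e).1⟩
  refine ⟨hx, ?_⟩
  have h2 : ForcesEq (pairName x y) (pairName x y') p :=
    h.trans (pairName_congr hx.symm (ForcesEq.refl _ _))
  exact upairName_inj_right (upairName_inj_right h2)

theorem pairName_check (x y : ZFSet.{u}) (p : P) :
    ForcesEq (pairName (check P x) (check P y)) (check P (ZFSet.pair x y)) p := by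
  have key : ∀ x y : ZFSet.{u},
      ForcesEq (upairName (check P x) (check P y)) (check P {x, y}) p := by
    intro x y
    refine ForcesEq.ext (fun ρ q hq hρ => ?_) (fun ρ q hq hρ => ?_)
    · refine forcesMem_check_iff.2 fun q' hq' => ?_
      obtain ⟨r, hr, e | e⟩ := forcesMem_upairName_iff.1 hρ q' hq'
      · exact ⟨r, hr, x, by simp, e⟩
      · exact ⟨r, hr, y, by simp, e⟩
    · refine forcesMem_upairName_iff.2 fun q' hq' => ?_
      obtain ⟨r, hr, z, hz, e⟩ := forcesMem_check_iff.1 hρ q' hq'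
      rw [ZFSet.mem_pair] at hz
      obtain rfl | rfl := hz
      · exact ⟨r, hr, Or.inl e⟩
      · exact ⟨r, hr, Or.inr e⟩
  have h1 := key x x
  rw [ZFSet.pair_eq_singleton] at h1
  exact (upairName_congr h1 (key x y)).trans (key _ _)

theorem forces_pairMem_iff {x y f : Name.{u} P} {p : P} :
    Forces (.pairMem x y f) p ↔ ForcesMem (pairName x y) f p := by
  constructor
  · intro h
    refine ForcesMem.of_dense fun q hq => ?_
    obtain ⟨r, hr, z, hz, e⟩ := h q hq
    rw [forces_isPair_iff] at e
    exact ⟨r, hr, ForcesMem.congr_left hz e⟩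
  · intro h
    exact forces_ex_of (pairName x y) ⟨h, forces_isPair_iff.2 (ForcesEq.refl _ _)⟩

theorem pairName_eq_check_pair {x y : Name.{u} P} {a b : ZFSet.{u}} {p : P}
    (h : ForcesEq (pairName x y) (check P (ZFSet.pair a b)) p) :
    ForcesEq x (check P a) p ∧ ForcesEq y (check P b) p :=
  pairName_inj (h.trans (pairName_check a b p).symm)

end Check

/-! ### Names of ordinals take ground model values -/

section Ordinals

variable {P : Type v} [Preorder P]

theorem forces_isOrdinal_of_mem {α x : Name.{u} P} {p : P} (h : Forces (.isOrdinal α) p)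
    (hx : ForcesMem x α p) : Forces (.isOrdinal x) p := by
  refine ⟨fun y q hq hy z q' hq' hz => ?_, fun y q hq hy => ?_⟩
  · exact h.2 x p le_rfl hx y q hq hy z q' hq' hz
  · exact h.2 y q hq (h.1 x p le_rfl hx y q hq hy)

/-- Take the least β such that some condition above `p` bounds the elements of `α` by β. That
condition forces `α` to be β: if some γ < β were kept out of `α` by a stronger condition,
transitivity would keep out everything above γ, and γ would be a smaller bound. -/
theorem exists_forcesEq_check_toZFSet [Small.{u} P] {α : Name.{u} P} {p : P}
    (h : Forces (.isOrdinal α) p) :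
    ∃ r, p ≤ r ∧ ∃ o : Ordinal.{u}, ForcesEq α (check P o.toZFSet) r := by
  induction α generalizing p with
  | mk ι a s ih =>
    let Bd : P → Ordinal.{u} → Prop := fun q β => ∀ i, ∀ q', q ≤ q' → s i ≤ q' →
      ∃ r, q' ≤ r ∧ ∃ γ < β, ForcesEq (a i) (check P γ.toZFSet) r
    have hex : ∃ β, ∃ q, p ≤ q ∧ Bd q β := by
      -- A bound exists because the pairs (subname, condition) form a small type; pairs without
      -- relevance get the value 0.
      have key : ∀ z : ι × P, ∃ γ : Ordinal.{u}, p ≤ z.2 → s z.1 ≤ z.2 →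
          ∃ r, z.2 ≤ r ∧ ForcesEq (a z.1) (check P γ.toZFSet) r := by
        rintro ⟨i, q⟩
        by_cases hq : p ≤ q ∧ s i ≤ q
        · obtain ⟨r, hr, o, ho⟩ := ih i
            (forces_isOrdinal_of_mem (h.mono hq.1) (forcesMem_mk_self a s hq.2))
          exact ⟨o, fun _ _ => ⟨r, hr, ho⟩⟩
        · exact ⟨0, fun h1 h2 => absurd ⟨h1, h2⟩ hq⟩
      choose g hg using key
      have : BddAbove (Set.range g) := Ordinal.bddAbove_of_small
      obtain ⟨b, hb⟩ := this
      refine ⟨Order.succ b, p, le_rfl, fun i q hq hi => ?_⟩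
      obtain ⟨r, hr, e⟩ := hg (i, q) hq hi
      exact ⟨r, hr, _, Order.lt_succ_of_le (hb ⟨(i, q), rfl⟩), e⟩
    obtain ⟨β, ⟨q, hq, hβ⟩, hmin⟩ := WellFounded.has_min Ordinal.lt_wf
      {β | ∃ q, p ≤ q ∧ Bd q β} hex
    refine ⟨q, hq, β, ForcesEq.ext (fun ρ q' hq' hρ => ?_) (fun ρ q' hq' hρ => ?_)⟩
    · refine forcesMem_check_iff.2 fun q'' hq'' => ?_
      obtain ⟨r, hr, i, hi, e⟩ := forcesMem_mk.1 hρ q'' hq''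
      obtain ⟨r', hr', γ, hγ, e'⟩ := hβ i r (hq'.trans (hq''.trans hr)) hi
      exact ⟨r', hr.trans hr', γ.toZFSet, Ordinal.mem_toZFSet_iff.2 ⟨γ, hγ, rfl⟩,
        (e.mono hr').trans e'⟩
    · refine ForcesMem.of_dense fun q'' hq'' => ?_
      obtain ⟨r, hr, y, hy, e⟩ := forcesMem_check_iff.1 hρ q'' hq''
      obtain ⟨γ, hγ, rfl⟩ := Ordinal.mem_toZFSet_iff.1 hy
      by_contra hcon
      push Not at hcon
      have hqr : q ≤ r := hq'.trans (hq''.trans hr)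
      refine hmin γ ⟨r, hq.trans hqr, fun i q1 hq1 hi => ?_⟩ hγ
      obtain ⟨r1, hr1, δ, hδ, e1⟩ := hβ i q1 (hqr.trans hq1) hi
      have hrr1 := hq1.trans hr1
      have hmem : ForcesMem (a i) (Name.mk ι a s) r1 := forcesMem_mk_self a s (hi.trans hr1)
      obtain hlt | rfl | hlt := lt_trichotomy δ γ
      · exact ⟨r1, hr1, δ, hlt, e1⟩
      · exact absurd (hmem.congr_left (e1.trans (e.mono hrr1).symm)) (hcon r1 (hr.trans hrr1))
      · have h1 : ForcesMem ρ (a i) r1 :=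
          (forcesMem_check_of (Ordinal.mem_toZFSet_iff.2 ⟨γ, hlt, rfl⟩)
            (e.mono hrr1)).congr_right e1.symm
        exact absurd (h.1 (a i) r1 (hq.trans (hqr.trans hrr1)) hmem ρ r1 le_rfl h1)
          (hcon r1 (hr.trans hrr1))

end Ordinals

/-! ### Abstract fusion -/

section Fusion

/-- Chains are handled as sets, not as sequences, so that boundedness of chains can be stated in V_λ
without coding functions on ω. -/
theorem chain_of_succ {P : Type v} {X : P → P → Prop} (htr : ∀ p q r, X p q → X q r → X p r) {f : ℕ → P}
    (hf : ∀ n, X (f n) (f (n + 1))) :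
    ∀ p ∈ Set.range f, ∀ q ∈ Set.range f, p = q ∨ X p q ∨ X q p := by
  have key : ∀ m n, m < n → X (f m) (f n) := by
    intro m n h
    induction n, h using Nat.le_induction with
    | base => exact hf m
    | succ n _ ih => exact htr _ _ _ ih (hf n)
  rintro _ ⟨m, rfl⟩ _ ⟨n, rfl⟩
  obtain h | rfl | h := lt_trichotomy m n
  · exact Or.inr (Or.inl (key m n h))
  · exact Or.inl rfl
  · exact Or.inr (Or.inr (key n m h))

variable {P : Type v} [Preorder P]

/-- The set `F` is predense above `q`. -/
def PredenseAbove (F : Set P) (q : P) : Prop :=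
  ∀ q', q ≤ q' → ∃ f ∈ F, ∃ r, q' ≤ r ∧ f ≤ r

/-- The set `D` is dense above `p`. -/
def DenseAbove (D : Set P) (p : P) : Prop :=
  ∀ q, p ≤ q → ∃ r, q ≤ r ∧ r ∈ D

/-- A fusion relation on a preorder: a transitive relation whose chains are bounded, such that every
condition has a successor that reduces a given dense set to a finite subset. -/
structure IsFusion (X : P → P → Prop) : Prop where
  le : ∀ p q, X p q → p ≤ q
  trans : ∀ p q r, X p q → X q r → X p r
  chain : ∀ C : Set P, (∀ p ∈ C, ∀ q ∈ C, p = q ∨ X p q ∨ X q p) → ∃ q, ∀ p ∈ C, p ≤ q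
  step : ∀ p, ∀ D : Set P, DenseAbove D p →
    ∃ q, X p q ∧ ∃ F : Set P, F.Finite ∧ F ⊆ D ∧ PredenseAbove F q

theorem PredenseAbove.mono {F : Set P} {p q : P} (h : PredenseAbove F p) (hpq : p ≤ q) :
    PredenseAbove F q :=
  fun q' hq' => h q' (hpq.trans hq')

/-- Treat `D n` in the n-th fusion step; its finite set stays predense above the bound of the whole
sequence. -/
theorem IsFusion.exists_forall_predenseAbove {X : P → P → Prop} (hX : IsFusion X) (p : P)
    (D : ℕ → Set P) (hD : ∀ n, DenseAbove (D n) p) :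
    ∃ q, p ≤ q ∧ ∀ n, ∃ F : Set P, F.Finite ∧ F ⊆ D n ∧ PredenseAbove F q := by
  have key : ∀ n (q : {q // p ≤ q}), ∃ q' : {q // p ≤ q}, X q.1 q'.1 ∧
      ∃ F : Set P, F.Finite ∧ F ⊆ D n ∧ PredenseAbove F q'.1 := by
    rintro n ⟨q, hq⟩
    obtain ⟨q', hX', h⟩ := hX.step q (D n) fun r hr => hD n r (hq.trans hr)
    exact ⟨⟨q', hq.trans (hX.le _ _ hX')⟩, hX', h⟩
  choose g hg hg' using key
  let f : ℕ → {q // p ≤ q} := fun n => Nat.rec ⟨p, le_rfl⟩ (fun n q => g n q) n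
  obtain ⟨q, hq⟩ := hX.chain (Set.range fun n => (f n).1)
    (chain_of_succ hX.trans fun n => hg n (f n))
  refine ⟨q, hq _ ⟨0, rfl⟩, fun n => ?_⟩
  obtain ⟨F, h1, h2, h3⟩ := hg' n (f n)
  exact ⟨F, h1, h2, h3.mono (hq _ ⟨n + 1, rfl⟩)⟩

end Fusion

/-! ### Natural numbers and sequences as sets -/

section Naturals

theorem mem_omega_iff {x : ZFSet.{u}} : x ∈ ZFSet.omega.{u} ↔ ∃ n, x = natSet n := by
  induction x using Quotient.inductionOn with
  | h x =>
    constructor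
    · rintro ⟨⟨n⟩, hn⟩
      exact ⟨n, ZFSet.sound hn⟩
    · rintro ⟨n, hn⟩
      exact ⟨⟨n⟩, ZFSet.exact hn⟩

theorem natSet_succ (n : ℕ) : natSet.{u} (n + 1) = insert (natSet n) (natSet n) := rfl

theorem mem_natSet_iff {n : ℕ} {x : ZFSet.{u}} : x ∈ natSet n ↔ ∃ m < n, x = natSet m := by
  induction n with
  | zero => exact iff_of_false (ZFSet.notMem_empty x) (by simp)
  | succ n ih =>
    rw [natSet_succ, ZFSet.mem_insert_iff, ih]
    constructor
    · rintro (rfl | ⟨m, hm, rfl⟩)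
      · exact ⟨n, by omega, rfl⟩
      · exact ⟨m, by omega, rfl⟩
    · rintro ⟨m, hm, rfl⟩
      obtain h | rfl := Nat.lt_succ_iff_lt_or_eq.1 hm
      · exact Or.inr ⟨m, h, rfl⟩
      · exact Or.inl rfl

theorem natSet_mem_natSet {m n : ℕ} (h : m < n) : natSet.{u} m ∈ natSet.{u} n :=
  mem_natSet_iff.2 ⟨m, h, rfl⟩

theorem natSet_injective : Function.Injective natSet.{u} := by
  intro m n h
  by_contra hne
  obtain hlt | hlt := lt_or_gt_of_ne hne
  · exact ZFSet.mem_irrefl _ (h ▸ natSet_mem_natSet.{u} hlt)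
  · exact ZFSet.mem_irrefl _ (h ▸ natSet_mem_natSet.{u} hlt)

theorem pair_mem_seqSet {f : ℕ → ZFSet.{u}} {n : ℕ} {y : ZFSet.{u}} :
    ZFSet.pair (natSet n) y ∈ seqSet f ↔ y = f n := by
  rw [seqSet, ZFSet.mem_range]
  constructor
  · rintro ⟨m, hm⟩
    obtain ⟨h1, rfl⟩ := ZFSet.pair_inj.1 hm
    rw [natSet_injective h1]
  · rintro rfl
    exact ⟨n, rfl⟩

theorem mem_seqSet {f : ℕ → ZFSet.{u}} {z : ZFSet.{u}} :
    z ∈ seqSet f ↔ ∃ n, z = ZFSet.pair (natSet n) (f n) := by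
  rw [seqSet, ZFSet.mem_range]
  exact exists_congr fun n => eq_comm

end Naturals

/-! ### Fusion implies that the forcing is bounding -/

section Bounding

variable {P : Type v} [Preorder P] [Small.{u} P]

theorem exists_natSet_of_mem_omega {σ : Name.{u} P} {p : P}
    (h : ForcesMem σ (check P ZFSet.omega.{u}) p) :
    ∃ r, p ≤ r ∧ ∃ n, ForcesEq σ (check P (natSet n)) r := by
  obtain ⟨r, hr, y, hy, e⟩ := forcesMem_check_iff.1 h p le_rfl
  obtain ⟨n, rfl⟩ := mem_omega_iff.1 hy
  exact ⟨r, hr, n, e⟩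

theorem seqSet_mem_funs (g : ℕ → ℕ) :
    seqSet.{u} (fun n => natSet (g n)) ∈ ZFSet.funs ZFSet.omega.{u} ZFSet.omega.{u} := by
  rw [ZFSet.mem_funs]
  refine ⟨fun z hz => ?_, fun z hz => ?_⟩
  · obtain ⟨n, rfl⟩ := mem_seqSet.1 hz
    exact ZFSet.pair_mem_prod.2 ⟨mem_omega_iff.2 ⟨_, rfl⟩, mem_omega_iff.2 ⟨_, rfl⟩⟩
  · obtain ⟨n, rfl⟩ := mem_omega_iff.1 hz
    exact ⟨natSet (g n), pair_mem_seqSet.2 rfl, fun y (hy : ZFSet.pair _ y ∈ _) =>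
      pair_mem_seqSet (f := fun n => natSet (g n)).1 hy⟩

/-- The conditions that decide f(n) are dense. Fusion leaves finitely many of them for each n, and
g(n) bounds the finitely many values they decide. -/
theorem IsFusion.isOmegaOmegaBounding {X : P → P → Prop} (hX : IsFusion X) :
    IsOmegaOmegaBounding.{u} P := by
  intro p0 f p hp hf q hq
  replace hf := hf.mono hq
  obtain ⟨⟨-, hfun⟩, hval⟩ := hf
  let D : ℕ → Set P := fun n =>
    {r | ∃ m, ForcesMem (pairName (check P (natSet n)) (check P (natSet m))) f r}
  have hD : ∀ n, DenseAbove (D n) q := by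
    intro n r hr
    have hn : ForcesMem (check P (natSet.{u} n)) (check P ZFSet.omega.{u}) r :=
      forcesMem_check_check_iff.2 (mem_omega_iff.2 ⟨n, rfl⟩)
    obtain ⟨r1, hr1, y, hy⟩ := (hfun _ r hr hn).1 r le_rfl
    have hy' := hval _ r1 (hr.trans hr1) (ForcesMem.mono hn hr1) y r1 le_rfl hy
    obtain ⟨r2, hr2, m, e⟩ := exists_natSet_of_mem_omega hy'
    rw [forces_pairMem_iff] at hy
    exact ⟨r2, hr1.trans hr2, m,
      (hy.mono hr2).congr_left (pairName_congr (ForcesEq.refl _ _) e)⟩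
  obtain ⟨r, hr, hF⟩ := hX.exists_forall_predenseAbove q D hD
  choose F hfin hsub hpre using hF
  have hbd : ∀ n, ∃ N, ∀ r ∈ F n, ∃ m ≤ N,
      ForcesMem (pairName (check P (natSet n)) (check P (natSet m))) f r := by
    intro n
    choose! m hm using fun r (hr : r ∈ F n) => hsub n hr
    obtain ⟨N, hN⟩ := ((hfin n).image m).bddAbove
    exact ⟨N, fun r hr => ⟨m r, hN ⟨r, hr, rfl⟩, hm r hr⟩⟩
  choose g hg using hbd
  refine ⟨r, hr, check P (seqSet fun n => natSet (g n)),
    forcesMem_check_check_iff.2 (seqSet_mem_funs g), ?_⟩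
  intro σ q1 hq1 hσ a b q2 hq2 ha q3 hq3 hb q4 hq4
  rw [forces_pairMem_iff] at ha hb
  obtain ⟨r5, hr5, n, e⟩ := exists_natSet_of_mem_omega
    (ForcesMem.mono hσ (hq2.trans (hq3.trans hq4)))
  obtain ⟨r6, hr6, w, hw, e6⟩ := forcesMem_check_iff.1 (hb.mono (hq4.trans hr5)) r5 le_rfl
  obtain ⟨k, rfl⟩ := mem_seqSet.1 hw
  obtain ⟨ek, eb⟩ := pairName_eq_check_pair e6
  have hnk := natSet_injective (forcesEq_check_iff.1 ((e.mono hr6).symm.trans ek))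
  subst hnk
  have hr_r6 : r ≤ r6 := hq1.trans (hq2.trans (hq3.trans (hq4.trans (hr5.trans hr6))))
  obtain ⟨d, hd, r7, hr7, hdr⟩ := hpre n r6 hr_r6
  obtain ⟨m, hm, hmem⟩ := hg n d hd
  have hn : ForcesMem (check P (natSet.{u} n)) (check P ZFSet.omega.{u}) r7 :=
    forcesMem_check_check_iff.2 (mem_omega_iff.2 ⟨n, rfl⟩)
  have ha' : ForcesMem (pairName (check P (natSet n)) a) f r7 :=
    (ha.mono (hq3.trans (hq4.trans (hr5.trans (hr6.trans hr7))))).congr_left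
      (pairName_congr (ek.mono hr7) (ForcesEq.refl _ _))
  have ea : ForcesEq a (check P (natSet m)) r7 :=
    (hfun _ r7 (hr.trans (hr_r6.trans hr7)) hn).2 a (check P (natSet m)) r7 le_rfl
      (forces_pairMem_iff.2 ha') r7 le_rfl (forces_pairMem_iff.2 (hmem.mono hdr))
  refine ⟨r7, hr5.trans (hr6.trans hr7), ?_⟩
  obtain hlt | rfl := hm.lt_or_eq
  · left
    exact ((forcesMem_check_check_iff.2 (natSet_mem_natSet hlt)).congr_left ea.symm).congr_right
      (eb.mono hr7).symm
  · right
    exact ea.trans (eb.mono hr7).symm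

end Bounding

/-! ### First-order definability in V_λ and elementary substructures -/

open FirstOrder FirstOrder.Language

section FirstOrder

variable {P : Type v} [Preorder P] {e : P → ZFSet.{u}} {o : Ordinal.{u}}

/-- A relation on `V_o` with countably many variables is first-order definable in the structure
`(V_o; ∈, P, ≤)`. -/
def IsFO (φ : (ℕ → Vset e o) → Prop) : Prop :=
  ∃ ψ : posetLanguage.Formula ℕ, ∀ v, ψ.Realize v ↔ φ v

namespace IsFO

theorem mem {i j : ℕ} : IsFO fun v : ℕ → Vset e o => (v i).1 ∈ (v j).1 := by
  refine ⟨Relations.formula₂ (L := posetLanguage) PosetRel.mem (Term.var i) (Term.var j),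
    fun v => Formula.realize_rel₂⟩

theorem eq {i j : ℕ} : IsFO fun v : ℕ → Vset e o => v i = v j := by
  refine ⟨Term.equal (Term.var i) (Term.var j), fun v => ?_⟩
  rw [Formula.realize_equal]
  rfl

theorem carrier {i : ℕ} : IsFO fun v : ℕ → Vset e o => ∃ p, e p = (v i).1 := by
  refine ⟨Relations.formula₁ (L := posetLanguage) PosetRel.carrier (Term.var i),
    fun v => Formula.realize_rel₁⟩

theorem le {i j : ℕ} : IsFO fun v : ℕ → Vset e o =>
    ∃ p q, p ≤ q ∧ e p = (v i).1 ∧ e q = (v j).1 := by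
  refine ⟨Relations.formula₂ (L := posetLanguage) PosetRel.le (Term.var i) (Term.var j),
    fun v => Formula.realize_rel₂⟩

variable {φ ψ : (ℕ → Vset e o) → Prop}

theorem not (h : IsFO φ) : IsFO fun v => ¬ φ v := by
  obtain ⟨f, hf⟩ := h
  exact ⟨f.not, fun v => by rw [Formula.realize_not, hf]⟩

theorem and (h : IsFO φ) (h' : IsFO ψ) : IsFO fun v => φ v ∧ ψ v := by
  obtain ⟨f, hf⟩ := h
  obtain ⟨g, hg⟩ := h'
  exact ⟨f ⊓ g, fun v => by rw [Formula.realize_inf, hf, hg]⟩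

theorem or (h : IsFO φ) (h' : IsFO ψ) : IsFO fun v => φ v ∨ ψ v := by
  obtain ⟨f, hf⟩ := h
  obtain ⟨g, hg⟩ := h'
  exact ⟨f ⊔ g, fun v => by rw [Formula.realize_sup, hf, hg]⟩

theorem imp (h : IsFO φ) (h' : IsFO ψ) : IsFO fun v => φ v → ψ v := by
  obtain ⟨f, hf⟩ := h
  obtain ⟨g, hg⟩ := h'
  exact ⟨f.imp g, fun v => by rw [Formula.realize_imp, hf, hg]⟩

theorem iff (h : IsFO φ) (h' : IsFO ψ) : IsFO fun v => (φ v ↔ ψ v) := by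
  obtain ⟨f, hf⟩ := h
  obtain ⟨g, hg⟩ := h'
  exact ⟨f.iff g, fun v => by rw [Formula.realize_iff, hf, hg]⟩

theorem congr (h : IsFO φ) (hφ : ∀ v, φ v ↔ ψ v) : IsFO ψ := by
  obtain ⟨f, hf⟩ := h
  exact ⟨f, fun v => (hf v).trans (hφ v)⟩

end IsFO

/-- The valuation `v` with the value `x` put in front. -/
def consVar {N : Type w} (x : N) (v : ℕ → N) : ℕ → N
  | 0 => x
  | k + 1 => v k

/-- Existential quantification over the variable `0`, with the other variables shifted. -/
def exFormula (ψ : posetLanguage.Formula ℕ) : posetLanguage.Formula ℕ :=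
  BoundedFormula.ex (BoundedFormula.relabel (n := 1)
    (fun k : ℕ => Nat.casesOn k (Sum.inr 0) Sum.inl : ℕ → ℕ ⊕ Fin 1) ψ)

theorem realize_exFormula {N : Type w} [posetLanguage.Structure N]
    (ψ : posetLanguage.Formula ℕ) (v : ℕ → N) :
    (exFormula ψ).Realize v ↔ ∃ x, ψ.Realize (consVar x v) := by
  rw [exFormula, Formula.Realize, BoundedFormula.realize_ex]
  refine exists_congr fun x => ?_
  rw [BoundedFormula.realize_relabel, Formula.Realize, iff_eq_eq]
  congr 1
  · funext k
    cases k <;> rfl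
  · exact Subsingleton.elim _ _

namespace IsFO

theorem ex {φ : (ℕ → Vset e o) → Vset e o → Prop}
    (h : IsFO fun w => φ (fun k => w (k + 1)) (w 0)) : IsFO fun v => ∃ x, φ v x := by
  obtain ⟨f, hf⟩ := h
  exact ⟨exFormula f, fun v => by
    rw [realize_exFormula]
    exact exists_congr fun x => hf _⟩

theorem all {φ : (ℕ → Vset e o) → Vset e o → Prop}
    (h : IsFO fun w => φ (fun k => w (k + 1)) (w 0)) : IsFO fun v => ∀ x, φ v x :=
  (IsFO.ex (φ := fun v x => ¬ φ v x) h.not).not.congr fun v => by simp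

end IsFO

/-- Tarski–Vaught: an elementary substructure has witnesses for definable properties. -/
theorem exists_mem_of_isFO (M : posetLanguage.ElementarySubstructure (Vset e o))
    {φ : Vset e o → Vset e o → Vset e o → Vset e o → Prop}
    (h : IsFO fun w => φ (w 1) (w 2) (w 3) (w 0)) {a b c : Vset e o} (ha : a ∈ M) (hb : b ∈ M)
    (hc : c ∈ M) (hx : ∃ x, φ a b c x) : ∃ x ∈ M, φ a b c x := by
  obtain ⟨f, hf⟩ := h
  -- Putting the witness at variable 0 moves the parameters to variables 1, 2 and 3.
  let v : ℕ → M := fun k => [(⟨a, ha⟩ : M), ⟨b, hb⟩].getD k ⟨c, hc⟩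
  have h1 : (exFormula f).Realize (M.subtype ∘ v) := by
    rw [realize_exFormula]
    exact hx.imp fun x hx => (hf _).2 hx
  rw [M.subtype.map_formula, realize_exFormula] at h1
  obtain ⟨x, hx⟩ := h1
  rw [← M.subtype.map_formula, hf] at hx
  exact ⟨x.1, x.2, hx⟩

/-! ### Set-theoretic notions in `V_o` -/

theorem mem_vonNeumann_of_mem {x y : ZFSet.{u}} (hx : x ∈ y) (hy : y ∈ ZFSet.vonNeumann o) :
    x ∈ ZFSet.vonNeumann o :=
  (ZFSet.isTransitive_vonNeumann o).mem_trans hx hy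

theorem mem_vonNeumann_of_pair_mem {x y z : ZFSet.{u}} (h : ZFSet.pair x y ∈ z)
    (hz : z ∈ ZFSet.vonNeumann o) : x ∈ ZFSet.vonNeumann o ∧ y ∈ ZFSet.vonNeumann o := by
  have h1 : ({x, y} : ZFSet) ∈ ZFSet.vonNeumann o :=
    mem_vonNeumann_of_mem (by simp [ZFSet.pair]) (mem_vonNeumann_of_mem h hz)
  exact ⟨mem_vonNeumann_of_mem (by simp) h1, mem_vonNeumann_of_mem (by simp) h1⟩

/-- V_o is transitive, so quantifying over elements inside V_o loses nothing. The same absoluteness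
underlies the lemmas on ordered pairs and triples. -/
theorem IsFO.eq_upair {i j k : ℕ} :
    IsFO fun v : ℕ → Vset e o => (v i).1 = {(v j).1, (v k).1} := by
  have : IsFO fun v : ℕ → Vset e o => (v j).1 ∈ (v i).1 ∧ (v k).1 ∈ (v i).1 ∧
      ∀ w : Vset e o, w.1 ∈ (v i).1 → w = v j ∨ w = v k :=
    .and .mem (.and .mem (.all (.imp .mem (.or .eq .eq))))
  refine this.congr fun v => ?_
  constructor
  · rintro ⟨h1, h2, h3⟩
    ext w
    rw [ZFSet.mem_pair]
    constructor
    · intro hw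
      exact (h3 ⟨w, mem_vonNeumann_of_mem hw (v i).2⟩ hw).imp (congrArg Subtype.val)
        (congrArg Subtype.val)
    · rintro (rfl | rfl) <;> assumption
  · intro h
    refine ⟨by simp [h], by simp [h], fun w hw => ?_⟩
    rw [h, ZFSet.mem_pair] at hw
    exact hw.imp Subtype.ext Subtype.ext

theorem IsFO.eq_pair {i j k : ℕ} :
    IsFO fun v : ℕ → Vset e o => (v i).1 = ZFSet.pair (v j).1 (v k).1 := by
  have : IsFO fun v : ℕ → Vset e o => ∃ a b : Vset e o, a.1 = {(v j).1, (v j).1} ∧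
      b.1 = {(v j).1, (v k).1} ∧ (v i).1 = {a.1, b.1} :=
    .ex (.ex (.and .eq_upair (.and .eq_upair .eq_upair)))
  refine this.congr fun v => ?_
  constructor
  · rintro ⟨a, b, ha, hb, h⟩
    rw [h, ha, hb, ZFSet.pair, ZFSet.pair_eq_singleton]
  · intro h
    rw [ZFSet.pair, ← ZFSet.pair_eq_singleton] at h
    exact ⟨⟨_, mem_vonNeumann_of_mem (by simp [h]) (v i).2⟩,
      ⟨_, mem_vonNeumann_of_mem (by simp [h]) (v i).2⟩, rfl, rfl, h⟩

theorem IsFO.pair_mem {i j k : ℕ} :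
    IsFO fun v : ℕ → Vset e o => ZFSet.pair (v i).1 (v j).1 ∈ (v k).1 := by
  have : IsFO fun v : ℕ → Vset e o => ∃ z : Vset e o, z.1 = ZFSet.pair (v i).1 (v j).1 ∧
      z.1 ∈ (v k).1 := .ex (.and .eq_pair .mem)
  refine this.congr fun v => ⟨?_, fun h => ⟨⟨_, mem_vonNeumann_of_mem h (v k).2⟩, rfl, h⟩⟩
  rintro ⟨z, hz, h⟩
  rwa [← hz]

theorem IsFO.triple_mem {i j k l : ℕ} : IsFO fun v : ℕ → Vset e o =>
    ZFSet.pair (v i).1 (ZFSet.pair (v j).1 (v k).1) ∈ (v l).1 := by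
  have : IsFO fun v : ℕ → Vset e o => ∃ z : Vset e o, z.1 = ZFSet.pair (v j).1 (v k).1 ∧
      ZFSet.pair (v i).1 z.1 ∈ (v l).1 := .ex (.and .eq_pair .pair_mem)
  refine this.congr fun v => ⟨?_, fun h => ?_⟩
  · rintro ⟨z, hz, h⟩
    rwa [← hz]
  · exact ⟨⟨_, (mem_vonNeumann_of_pair_mem h (v l).2).2⟩, rfl, h⟩

/-- `x` is a condition. -/
def CondV (x : Vset e o) : Prop := ∃ p, e p = x.1

/-- `x ≤ y` in the forcing notion. -/
def LeV (x y : Vset e o) : Prop := ∃ p q, p ≤ q ∧ e p = x.1 ∧ e q = y.1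

theorem IsFO.condV {i : ℕ} : IsFO fun v : ℕ → Vset e o => CondV (v i) := .carrier

theorem IsFO.leV {i j : ℕ} : IsFO fun v : ℕ → Vset e o => LeV (v i) (v j) := .le

/-- `F` is finite in the sense of Kuratowski. -/
def FinV (F : Vset e o) : Prop :=
  ∀ I : Vset e o, (∃ z : Vset e o, z.1 ∈ I.1 ∧ ∀ w : Vset e o, ¬ w.1 ∈ z.1) →
    (∀ x : Vset e o, x.1 ∈ I.1 → ∀ y : Vset e o, y.1 ∈ F.1 → ∃ z : Vset e o, z.1 ∈ I.1 ∧
      ∀ w : Vset e o, w.1 ∈ z.1 ↔ w.1 ∈ x.1 ∨ w = y) → F.1 ∈ I.1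

theorem IsFO.finV {i : ℕ} : IsFO fun v : ℕ → Vset e o => FinV (v i) :=
  .all (.imp (.ex (.and .mem (.all (.not .mem)))) (.imp (.all (.imp .mem (.all (.imp .mem
    (.ex (.and .mem (.all (.iff .mem (.or .mem .eq))))))))) .mem))

theorem powerset_mem_vonNeumann (ho : Order.IsSuccLimit o) {x : ZFSet.{u}}
    (hx : x ∈ ZFSet.vonNeumann o) : x.powerset ∈ ZFSet.vonNeumann o := by
  rw [ZFSet.mem_vonNeumann] at hx ⊢
  rw [ZFSet.rank_powerset]
  exact ho.succ_lt hx

theorem union_mem_vonNeumann {x y : ZFSet.{u}} (hx : x ∈ ZFSet.vonNeumann o)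
    (hy : y ∈ ZFSet.vonNeumann o) : x ∪ y ∈ ZFSet.vonNeumann o := by
  rw [ZFSet.mem_vonNeumann] at hx hy ⊢
  rw [ZFSet.rank_union]
  exact max_lt hx hy

theorem pairSep_mem_vonNeumann (ho : Order.IsSuccLimit o) (p : ZFSet.{u} → ZFSet.{u} → Prop)
    {x y : ZFSet.{u}} (hx : x ∈ ZFSet.vonNeumann o)
    (hy : y ∈ ZFSet.vonNeumann o) : ZFSet.pairSep p x y ∈ ZFSet.vonNeumann o :=
  ZFSet.mem_vonNeumann_of_subset (fun _ hz => (ZFSet.mem_sep.1 hz).1)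
    (powerset_mem_vonNeumann ho (powerset_mem_vonNeumann ho (union_mem_vonNeumann hx hy)))

theorem sep_mem_vonNeumann (p : ZFSet.{u} → Prop) {x : ZFSet.{u}}
    (hx : x ∈ ZFSet.vonNeumann o) : ZFSet.sep p x ∈ ZFSet.vonNeumann o :=
  ZFSet.mem_vonNeumann_of_subset (fun _ hz => (ZFSet.mem_sep.1 hz).1) hx

theorem finV_iff {P : Type v} {e : P → ZFSet.{u}} {o : Ordinal.{u}} (ho : Order.IsSuccLimit o)
    {F : Vset e o} :
    FinV F ↔ (F.1 : Set ZFSet.{u}).Finite := by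
  constructor
  · intro h
    -- The test family is that of all finite subsets of `F`; it belongs to V_o because o is a limit.
    let I : Vset e o := ⟨ZFSet.sep (fun x => (x : Set ZFSet.{u}).Finite) F.1.powerset,
      sep_mem_vonNeumann _ (powerset_mem_vonNeumann ho F.2)⟩
    have memI : ∀ x, x ∈ I.1 ↔ x ⊆ F.1 ∧ (x : Set ZFSet.{u}).Finite := fun x => by
      simp [I]
    refine ((memI _).1 (h I ?_ ?_)).2
    · have h0 : (∅ : ZFSet.{u}) ∈ I.1 := by
        rw [memI]
        exact ⟨ZFSet.empty_subset _, by simp⟩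
      exact ⟨⟨∅, mem_vonNeumann_of_mem h0 I.2⟩, h0, fun w => ZFSet.notMem_empty _⟩
    · intro x hx y hy
      have h1 : insert y.1 x.1 ∈ I.1 := by
        rw [memI] at hx ⊢
        refine ⟨fun z hz => ?_, by simpa using hx.2⟩
        rw [ZFSet.mem_insert_iff] at hz
        obtain rfl | hz := hz
        exacts [hy, hx.1 hz]
      refine ⟨⟨_, mem_vonNeumann_of_mem h1 I.2⟩, h1, fun w => ?_⟩
      exact ZFSet.mem_insert_iff.trans (or_comm.trans (or_congr_right Subtype.ext_iff.symm))
  · intro h I h0 hI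
    have key : ∀ s : Set ZFSet.{u}, s.Finite → s ⊆ F.1 → ∃ z : Vset e o, z.1 ∈ I.1 ∧
        (z.1 : Set ZFSet.{u}) = s := by
      intro s hs
      induction s, hs using Set.Finite.induction_on with
      | empty =>
        intro _
        obtain ⟨z, hz, hz'⟩ := h0
        refine ⟨z, hz, Set.eq_empty_iff_forall_notMem.2 fun w hw => ?_⟩
        exact hz' ⟨w, mem_vonNeumann_of_mem hw z.2⟩ hw
      | @insert y s _ _ ih =>
        intro hs
        obtain ⟨x, hx, rfl⟩ := ih ((Set.subset_insert _ _).trans hs)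
        have hyF : y ∈ F.1 := hs (Set.mem_insert _ _)
        obtain ⟨z, hz, hz'⟩ := hI x hx ⟨y, mem_vonNeumann_of_mem hyF F.2⟩ hyF
        refine ⟨z, hz, Set.ext fun w => ⟨fun hw => ?_, fun hw => ?_⟩⟩
        · exact ((hz' ⟨w, mem_vonNeumann_of_mem hw z.2⟩).1 hw).symm.imp
            (congrArg Subtype.val) id
        · obtain rfl | hw := hw
          · exact (hz' ⟨w, mem_vonNeumann_of_mem hyF F.2⟩).2 (Or.inr rfl)
          · exact (hz' ⟨w, mem_vonNeumann_of_mem hw x.2⟩).2 (Or.inl hw)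
    obtain ⟨z, hz, h'⟩ := key _ h subset_rfl
    rwa [← SetLike.coe_injective h']

/-- Finite elements of an elementary substructure are subsets of it. -/
theorem mem_of_finite (M : posetLanguage.ElementarySubstructure (Vset e o)) {F : Vset e o}
    (hF : F ∈ M) (hfin : (F.1 : Set ZFSet.{u}).Finite) {x : Vset e o} (hx : x.1 ∈ F.1) :
    x ∈ M := by
  induction hn : (F.1 : Set ZFSet.{u}).ncard generalizing F with
  | zero =>
    rw [Set.ncard_eq_zero hfin] at hn
    exact absurd hx (Set.eq_empty_iff_forall_notMem.1 hn x.1)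
  | succ n ih =>
    -- Elementarity puts into `M` some element y of `F` and the set F \ {y}; either x = y or the
    -- induction applies to the smaller set.
    obtain ⟨y, hyM, hy⟩ := exists_mem_of_isFO M (φ := fun F _ _ y => y.1 ∈ F.1) .mem hF hF hF
      ⟨x, hx⟩
    obtain ⟨G, hGM, hG⟩ := exists_mem_of_isFO M
      (φ := fun F y _ G => ∀ w : Vset e o, w.1 ∈ G.1 ↔ w.1 ∈ F.1 ∧ ¬ w = y)
      (.all (.iff .mem (.and .mem (.not .eq)))) hF hyM hyM
      ⟨⟨ZFSet.sep (fun w => w ≠ y.1) F.1, sep_mem_vonNeumann _ F.2⟩, fun w =>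
        (ZFSet.mem_sep (p := fun w => w ≠ y.1)).trans
          (and_congr_right fun _ => not_congr Subtype.ext_iff.symm)⟩
    have hGF : (G.1 : Set ZFSet.{u}) = (F.1 : Set ZFSet.{u}) \ {y.1} := by
      ext w
      constructor
      · intro hw
        have := (hG ⟨w, mem_vonNeumann_of_mem hw G.2⟩).1 hw
        exact ⟨this.1, fun h => this.2 (Subtype.ext h)⟩
      · intro hw
        exact (hG ⟨w, mem_vonNeumann_of_mem hw.1 F.2⟩).2
          ⟨hw.1, fun h => hw.2 (congrArg Subtype.val h)⟩
    by_cases hxy : x = y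
    · rwa [hxy]
    · refine ih hGM (hGF ▸ hfin.sdiff) ((hG x).2 ⟨hx, hxy⟩) ?_
      rw [hGF, Set.ncard_sdiff_singleton_of_mem hy, hn]
      rfl

end FirstOrder

/-! ### The value of a name, expressed inside V_λ -/

section Value

variable {P : Type v} [Preorder P] {e : P → ZFSet.{u}} {o : Ordinal.{u}}

/-- The triples `(σ, y, p)` in `W` satisfy the recursion of the relation "`p` forces that the name
`σ` is equal to the ground model set `y`". -/
def ClosedV (W : Vset e o) : Prop :=
  ∀ σ y p : Vset e o, ZFSet.pair σ.1 (ZFSet.pair y.1 p.1) ∈ W.1 →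
    (∀ τ s : Vset e o, ZFSet.pair τ.1 s.1 ∈ σ.1 → ∀ q : Vset e o, LeV p q → LeV s q →
      ∃ r : Vset e o, LeV q r ∧ ∃ z : Vset e o, z.1 ∈ y.1 ∧
        ZFSet.pair τ.1 (ZFSet.pair z.1 r.1) ∈ W.1) ∧
    (∀ z : Vset e o, z.1 ∈ y.1 → ∀ q : Vset e o, LeV p q →
      ∃ r : Vset e o, LeV q r ∧ ∃ τ s : Vset e o, ZFSet.pair τ.1 s.1 ∈ σ.1 ∧ LeV s r ∧
        ZFSet.pair τ.1 (ZFSet.pair z.1 r.1) ∈ W.1)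

/-- `r` forces that the name `α` is equal to the ground model set `x`. -/
def ValueV (α x r : Vset e o) : Prop :=
  ∃ W : Vset e o, ZFSet.pair α.1 (ZFSet.pair x.1 r.1) ∈ W.1 ∧ ClosedV W

theorem IsFO.closedV {i : ℕ} : IsFO fun v : ℕ → Vset e o => ClosedV (v i) :=
  .all (.all (.all (.imp .triple_mem (.and
    (.all (.all (.imp .pair_mem (.all (.imp .leV (.imp .leV (.ex (.and .leV
      (.ex (.and .mem .triple_mem))))))))))
    (.all (.imp .mem (.all (.imp .leV (.ex (.and .leV
      (.ex (.ex (.and .pair_mem (.and .leV .triple_mem))))))))))))))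

theorem IsFO.valueV {i j k : ℕ} : IsFO fun v : ℕ → Vset e o => ValueV (v i) (v j) (v k) :=
  .ex (.and .triple_mem .closedV)

theorem leV_iff (he : Function.Injective e) {x y : Vset e o} {p q : P} (hx : e p = x.1)
    (hy : e q = y.1) : LeV x y ↔ p ≤ q := by
  constructor
  · rintro ⟨p', q', h, hp, hq⟩
    rwa [he (hx.trans hp.symm), he (hy.trans hq.symm)]
  · exact fun h => ⟨p, q, h, hx, hy⟩

theorem nameSet_mk {P : Type v} {e : P → ZFSet.{u}} {ι : Type u}
    (a : ι → Name.{u} P) (s : ι → P) :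
    nameSet e (Name.mk ι a s) = ZFSet.range fun i => ZFSet.pair (nameSet e (a i)) (e (s i)) := by
  rw [nameSet]

theorem pair_mem_nameSet {P : Type v} {e : P → ZFSet.{u}} {ι : Type u}
    {a : ι → Name.{u} P} {s : ι → P} {τ c : ZFSet.{u}} :
    ZFSet.pair τ c ∈ nameSet e (Name.mk ι a s) ↔ ∃ i, nameSet e (a i) = τ ∧ e (s i) = c := by
  rw [nameSet_mk, ZFSet.mem_range]
  exact exists_congr fun i => ZFSet.pair_inj

variable [Small.{u} P]

/-- Each element of the value is the value of a subname, and subnames have smaller rank. Hence the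
values of names in V_λ stay in V_λ. -/
theorem rank_le_of_forcesEq {σ : Name.{u} P} {x : PSet.{u}} {p : P}
    (h : ForcesEq σ (checkPSet P x) p) : (ZFSet.mk x).rank ≤ (nameSet e σ).rank := by
  induction σ generalizing x p with
  | mk ι a s ih =>
    obtain ⟨κ, B⟩ := x
    rw [checkPSet, forcesEq_mk] at h
    rw [ZFSet.rank_le_iff]
    intro y hy
    induction y using Quotient.inductionOn with
    | h y =>
    obtain ⟨j, hj⟩ : y ∈ PSet.mk κ B := hy
    obtain ⟨r, -, i, -, e'⟩ := h.2 ⟨j, equivShrink P p⟩ p le_rfl (by simp)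
    have h1 := ih i e'
    have hj' : ZFSet.mk y = ZFSet.mk (B j) := ZFSet.sound hj
    change ZFSet.rank (ZFSet.mk y) < _
    rw [hj']
    refine h1.trans_lt (lt_trans ?_ (ZFSet.rank_lt_of_mem
      (pair_mem_nameSet.2 ⟨i, rfl, rfl⟩ : ZFSet.pair _ (e (s i)) ∈ nameSet e (Name.mk ι a s))))
    rw [ZFSet.pair, ZFSet.rank_pair, ZFSet.rank_singleton]
    exact (Order.lt_succ _).trans ((Order.lt_succ _).trans_le (le_max_left _ _))

/-- Soundness of any closed `W`, however chosen: its two clauses unfold the recursion of `ForcesEq`,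
and induction on the name turns them into the relation itself. -/
theorem ClosedV.forcesEq (he : Function.Injective e)
    (hV : ∀ p, e p ∈ ZFSet.vonNeumann o) {W : Vset e o} (hW : ClosedV W) {σ : Name.{u} P}
    {x : PSet.{u}} {p : P}
    (h : ZFSet.pair (nameSet e σ) (ZFSet.pair (ZFSet.mk x) (e p)) ∈ W.1) :
    ForcesEq σ (checkPSet P x) p := by
  induction σ generalizing x p with
  | mk ι a s ih =>
    obtain ⟨κ, B⟩ := x
    rw [checkPSet, forcesEq_mk]
    have h1 := mem_vonNeumann_of_pair_mem h W.2
    have h2 : ZFSet.mk (PSet.mk κ B) ∈ ZFSet.vonNeumann o := by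
      have : ({ZFSet.mk (PSet.mk κ B)} : ZFSet) ∈ ZFSet.vonNeumann o :=
        mem_vonNeumann_of_mem (by simp [ZFSet.pair]) h1.2
      exact mem_vonNeumann_of_mem (by simp) this
    obtain ⟨c1, c2⟩ := hW ⟨_, h1.1⟩ ⟨_, h2⟩ ⟨_, hV p⟩ h
    constructor
    · intro i q hq hi
      have hm : ZFSet.pair (nameSet e (a i)) (e (s i)) ∈ nameSet e (Name.mk ι a s) :=
        pair_mem_nameSet.2 ⟨i, rfl, rfl⟩
      obtain ⟨r, ⟨q', r', hqr, hq', hr'⟩, z, hz, hzW⟩ := c1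
        ⟨_, (mem_vonNeumann_of_pair_mem hm h1.1).1⟩ ⟨_, hV (s i)⟩ hm ⟨_, hV q⟩
        ((leV_iff he rfl rfl).2 hq) ((leV_iff he rfl rfl).2 hi)
      obtain rfl := he hq'
      obtain ⟨z, hzV⟩ := z
      induction z using Quotient.inductionOn with
      | h z =>
      obtain ⟨j, hj⟩ : z ∈ PSet.mk κ B := hz
      refine ⟨r', hqr, ⟨j, equivShrink P r'⟩, by simp, ih i ?_⟩
      have hj' : ZFSet.mk z = ZFSet.mk (B j) := ZFSet.sound hj
      rw [hr', ← hj']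
      exact hzW
    · rintro ⟨j, c⟩ q hq hj
      have hm : ZFSet.mk (B j) ∈ ZFSet.mk (PSet.mk κ B) := PSet.Mem.mk B j
      obtain ⟨r, ⟨q', r', hqr, hq', hr'⟩, τ, s', hm', ⟨s1, r1, hs, hs1, hr1⟩, hzW⟩ := c2
        ⟨_, mem_vonNeumann_of_mem hm h2⟩ hm ⟨_, hV q⟩ ((leV_iff he rfl rfl).2 hq)
      obtain rfl := he hq'
      obtain rfl := he (hr'.trans hr1.symm)
      obtain ⟨i, hi, hi'⟩ := pair_mem_nameSet.1 hm'
      obtain rfl := he (hs1.trans hi'.symm)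
      refine ⟨r', hqr, i, hs, ih i ?_⟩
      rw [hr', hi]
      exact hzW

theorem ValueV.forcesEq (he : Function.Injective e)
    (hV : ∀ p, e p ∈ ZFSet.vonNeumann o) {α x r : Vset e o} (h : ValueV α x r) {σ : Name.{u} P}
    {p : P} (hσ : nameSet e σ = α.1) (hp : e p = r.1) : ForcesEq σ (check P x.1) p := by
  obtain ⟨W, h, hW⟩ := h
  refine hW.forcesEq he hV ?_
  rwa [hσ, hp, show ZFSet.mk (Quotient.out x.1) = x.1 from Quotient.out_eq x.1]

/-- The witness `W` consists of all true triples whose name and value lie in a fixed V_b.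
Transitivity of V_b keeps subnames and elements inside, which makes `W` closed. -/
theorem valueV_of_forcesEq (he : Function.Injective e) (ho : Order.IsSuccLimit o)
    (hc : carrierSet e ∈ ZFSet.vonNeumann o) {α x r : Vset e o} {σ : Name.{u} P} {p : P}
    (hσ : nameSet e σ = α.1) (hp : e p = r.1) (h : ForcesEq σ (check P x.1) p) :
    ValueV α x r := by
  have hcar : ∀ q, e q ∈ carrierSet e := fun q => ZFSet.mem_range_self q
  have hV : ∀ q, e q ∈ ZFSet.vonNeumann o := fun q => mem_vonNeumann_of_mem (hcar q) hc
  -- Only with b < o is V_b, and hence `W`, an element of V_o.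
  obtain ⟨b, hbo, hαb, hxb⟩ : ∃ b < o, α.1 ∈ ZFSet.vonNeumann b ∧ x.1 ∈ ZFSet.vonNeumann b := by
    refine ⟨Order.succ (max α.1.rank x.1.rank), ho.succ_lt (max_lt (ZFSet.mem_vonNeumann.1 α.2)
      (ZFSet.mem_vonNeumann.1 x.2)), ?_, ?_⟩ <;> rw [ZFSet.mem_vonNeumann, Order.lt_succ_iff]
    exacts [le_max_left _ _, le_max_right _ _]
  let T := ZFSet.vonNeumann b
  have hT : T ∈ ZFSet.vonNeumann o := ZFSet.vonNeumann_mem_of_lt hbo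
  let W : Vset e o := ⟨ZFSet.pairSep (fun s z => ∃ (σ : Name.{u} P) (y : ZFSet.{u}) (p : P),
    nameSet e σ = s ∧ z = ZFSet.pair y (e p) ∧ ForcesEq σ (check P y) p) T
      (ZFSet.prod T (carrierSet e)), pairSep_mem_vonNeumann ho _ hT
        (pairSep_mem_vonNeumann ho _ hT hc)⟩
  have memW : ∀ s y c, ZFSet.pair s (ZFSet.pair y c) ∈ W.1 ↔ s ∈ T ∧ y ∈ T ∧
      ∃ (σ : Name.{u} P) (p : P), nameSet e σ = s ∧ e p = c ∧ ForcesEq σ (check P y) p := by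
    intro s y c
    constructor
    · intro hm
      obtain ⟨s', hs', z, hz, heq, σ, y', p, hσ, rfl, hf⟩ := ZFSet.mem_pairSep.1 hm
      obtain ⟨rfl, h2⟩ := ZFSet.pair_inj.1 heq
      obtain ⟨rfl, rfl⟩ := ZFSet.pair_inj.1 h2
      exact ⟨hs', (ZFSet.pair_mem_prod.1 hz).1, σ, p, hσ, rfl, hf⟩
    · rintro ⟨hs, hy, σ, p, rfl, rfl, hf⟩
      exact ZFSet.mem_pairSep.2 ⟨_, hs, _, ZFSet.pair_mem_prod.2 ⟨hy, hcar p⟩, rfl,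
        σ, y, p, rfl, rfl, hf⟩
  refine ⟨W, (memW _ _ _).2 ⟨hαb, hxb, σ, p, hσ, hp, h⟩, ?_⟩
  intro s y c hW
  obtain ⟨hs, hy, ⟨ι, a, d⟩, p, hσ, hp, hf⟩ := (memW _ _ _).1 hW
  have hf1 := fun (τ : Name.{u} P) (q : P) (hq : p ≤ q) (hτ : ForcesMem τ (Name.mk ι a d) q) =>
    forcesMem_check_iff.1 (hτ.congr_right (hf.mono hq)) q le_rfl
  constructor
  · rintro τ t hτ q ⟨p', q', hpq, hp', hq'⟩ ⟨t', q'', htq, ht', hq''⟩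
    obtain rfl := he (hq'.trans hq''.symm)
    obtain rfl := he (hp.trans hp'.symm)
    have hτT := (mem_vonNeumann_of_pair_mem hτ hs).1
    rw [← hσ, pair_mem_nameSet] at hτ
    obtain ⟨i, hi, hit⟩ := hτ
    obtain rfl := he (ht'.trans hit.symm)
    obtain ⟨r, hr, z, hz, hzr⟩ := hf1 _ q' hpq (forcesMem_mk_self a d htq)
    refine ⟨⟨e r, hV r⟩, ⟨q', r, hr, hq', rfl⟩, ⟨z, mem_vonNeumann_of_mem hz y.2⟩, hz, ?_⟩
    exact (memW _ _ _).2 ⟨hτT, mem_vonNeumann_of_mem hz hy, a i, r, hi, rfl, hzr⟩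
  · rintro z hz q ⟨p', q', hpq, hp', hq'⟩
    obtain rfl := he (hp.trans hp'.symm)
    have hzq : ForcesMem (check P z.1) (Name.mk ι a d) q' :=
      (forcesMem_check_check_iff.2 hz).congr_right (hf.mono hpq).symm
    obtain ⟨r, hr, i, hi, hzr⟩ := forcesMem_mk.1 hzq q' le_rfl
    have hτ : ZFSet.pair (nameSet e (a i)) (e (d i)) ∈ s.1 := by
      rw [← hσ, pair_mem_nameSet]
      exact ⟨i, rfl, rfl⟩
    refine ⟨⟨e r, hV r⟩, ⟨q', r, hr, hq', rfl⟩, ⟨_, (mem_vonNeumann_of_pair_mem hτ s.2).1⟩,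
      ⟨_, hV (d i)⟩, hτ, ⟨d i, r, hi, rfl, rfl⟩, ?_⟩
    exact (memW _ _ _).2 ⟨(mem_vonNeumann_of_pair_mem hτ hs).1, mem_vonNeumann_of_mem hz hy, a i, r,
      rfl, rfl, hzr.symm⟩

end Value

/-! ### Fusion implies properness -/

section Properness

variable {P : Type v} [Preorder P] {e : P → ZFSet.{u}} {o : Ordinal.{u}}

theorem exists_sepV {P : Type v} {e : P → ZFSet.{u}} {o : Ordinal.{u}} (p : ZFSet.{u} → Prop)
    {x : ZFSet.{u}} (hx : x ∈ ZFSet.vonNeumann o) :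
    ∃ Z : Vset e o, ∀ z, z ∈ Z.1 ↔ z ∈ x ∧ p z :=
  ⟨⟨ZFSet.sep p x, sep_mem_vonNeumann p hx⟩, fun _ => ZFSet.mem_sep⟩

theorem exists_pairSepV {P : Type v} {e : P → ZFSet.{u}} {o : Ordinal.{u}}
    (ho : Order.IsSuccLimit o) (p : ZFSet.{u} → ZFSet.{u} → Prop)
    {x y : ZFSet.{u}} (hx : x ∈ ZFSet.vonNeumann o) (hy : y ∈ ZFSet.vonNeumann o) :
    ∃ Z : Vset e o, ∀ a b, ZFSet.pair a b ∈ Z.1 ↔ a ∈ x ∧ b ∈ y ∧ p a b := by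
  refine ⟨⟨ZFSet.pairSep p x y, pairSep_mem_vonNeumann ho p hx hy⟩, fun a b => ?_⟩
  refine ZFSet.mem_pairSep.trans ⟨?_, fun ⟨ha, hb, h⟩ => ⟨a, ha, b, hb, rfl, h⟩⟩
  rintro ⟨a', ha, b', hb, h, hp⟩
  obtain ⟨rfl, rfl⟩ := ZFSet.pair_inj.1 h
  exact ⟨ha, hb, hp⟩

/-- `PredenseAbove` in `V_o`. -/
def PredenseV (F q : Vset e o) : Prop :=
  ∀ q' : Vset e o, LeV q q' → ∃ f : Vset e o, f.1 ∈ F.1 ∧ ∃ r : Vset e o, LeV q' r ∧ LeV f r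

/-- `IsFusion` in `V_o`. -/
def FusionV (X : Vset e o) : Prop :=
  (∀ p q r : Vset e o, ZFSet.pair p.1 q.1 ∈ X.1 → ZFSet.pair q.1 r.1 ∈ X.1 →
    ZFSet.pair p.1 r.1 ∈ X.1) ∧
  (∀ C : Vset e o, (∀ p : Vset e o, p.1 ∈ C.1 → CondV p) →
    (∀ p : Vset e o, p.1 ∈ C.1 → ∀ q : Vset e o, q.1 ∈ C.1 →
      p = q ∨ ZFSet.pair p.1 q.1 ∈ X.1 ∨ ZFSet.pair q.1 p.1 ∈ X.1) →
    ∃ q : Vset e o, CondV q ∧ ∀ p : Vset e o, p.1 ∈ C.1 → LeV p q) ∧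
  (∀ p : Vset e o, CondV p → ∀ D : Vset e o,
    (∀ q : Vset e o, LeV p q → ∃ r : Vset e o, LeV q r ∧ r.1 ∈ D.1) →
    ∃ q : Vset e o, CondV q ∧ ZFSet.pair p.1 q.1 ∈ X.1 ∧ ∃ F : Vset e o, FinV F ∧
      (∀ f : Vset e o, f.1 ∈ F.1 → f.1 ∈ D.1) ∧ PredenseV F q)

theorem IsFO.predenseV {i j : ℕ} : IsFO fun v : ℕ → Vset e o => PredenseV (v i) (v j) :=
  .all (.imp .leV (.ex (.and .mem (.ex (.and .leV .leV)))))

theorem IsFO.fusionV {i : ℕ} : IsFO fun v : ℕ → Vset e o => FusionV (v i) :=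
  .and (.all (.all (.all (.imp .pair_mem (.imp .pair_mem .pair_mem)))))
    (.and
      (.all (.imp (.all (.imp .mem .condV))
        (.imp (.all (.imp .mem (.all (.imp .mem (.or .eq (.or .pair_mem .pair_mem))))))
          (.ex (.and .condV (.all (.imp .mem .leV)))))))
      (.all (.imp .condV (.all (.imp (.all (.imp .leV (.ex (.and .leV .mem))))
        (.ex (.and .condV (.and .pair_mem (.ex (.and .finV
          (.and (.all (.imp .mem .mem)) .predenseV)))))))))))

/-- The witness is the graph of `X` on codes. `FusionV` omits the clause that `X` refines the order,
since bounds of chains already provide the extension. -/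
theorem IsFusion.exists_fusionV [Small.{u} P] {X : P → P → Prop} (hX : IsFusion X)
    (he : Function.Injective e) (ho : Order.IsSuccLimit o)
    (hc : carrierSet e ∈ ZFSet.vonNeumann o) : ∃ Y : Vset e o, FusionV Y := by
  have hcar : ∀ q, e q ∈ carrierSet e := fun q => ZFSet.mem_range_self q
  have hV : ∀ q, e q ∈ ZFSet.vonNeumann o := fun q => mem_vonNeumann_of_mem (hcar q) hc
  obtain ⟨Y, memY⟩ := exists_pairSepV (e := e) ho (fun x y => ∃ p q, e p = x ∧ e q = y ∧ X p q) hc hc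
  replace memY : ∀ x y, ZFSet.pair x y ∈ Y.1 ↔ ∃ p q, e p = x ∧ e q = y ∧ X p q := fun x y =>
    (memY x y).trans ⟨fun h => h.2.2, fun ⟨p, q, hp, hq, h⟩ =>
      ⟨hp ▸ hcar p, hq ▸ hcar q, p, q, hp, hq, h⟩⟩
  have memY' : ∀ p q, ZFSet.pair (e p) (e q) ∈ Y.1 ↔ X p q := by
    intro p q
    rw [memY]
    constructor
    · rintro ⟨p', q', h1, h2, h⟩
      rwa [← he h1, ← he h2]
    · exact fun h => ⟨p, q, rfl, rfl, h⟩
  refine ⟨Y, fun x y z h1 h2 => ?_, fun C hC hcomp => ?_, fun x hx D hD => ?_⟩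
  · obtain ⟨p, q, hp, hq, h⟩ := (memY _ _).1 h1
    obtain ⟨q', r, hq', hr, h'⟩ := (memY _ _).1 h2
    obtain rfl := he (hq.trans hq'.symm)
    exact (memY _ _).2 ⟨p, r, hp, hr, hX.trans _ _ _ h h'⟩
  · obtain ⟨q, hq⟩ := hX.chain {p | e p ∈ C.1} (by
      intro p hp q hq
      obtain h | h | h := hcomp ⟨e p, hV p⟩ hp ⟨e q, hV q⟩ hq
      · exact Or.inl (he (congrArg Subtype.val h))
      · exact Or.inr (Or.inl ((memY' _ _).1 h))
      · exact Or.inr (Or.inr ((memY' _ _).1 h)))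
    refine ⟨⟨e q, hV q⟩, ⟨q, rfl⟩, fun x hx => ?_⟩
    obtain ⟨p, hp⟩ := hC x hx
    exact ⟨p, q, hq p (show e p ∈ C.1 from hp ▸ hx), hp, rfl⟩
  · obtain ⟨p, hp⟩ := hx
    obtain ⟨q, hpq, F, hfin, hFD, hF⟩ := hX.step p {d | e d ∈ D.1} (by
      intro q hq
      obtain ⟨r, ⟨q', r', hqr, hq', hr'⟩, hr⟩ := hD ⟨e q, hV q⟩ ⟨p, q, hq, hp, rfl⟩
      obtain rfl := he hq'
      exact ⟨r', hqr, show e r' ∈ D.1 from hr' ▸ hr⟩)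
    obtain ⟨G, memG⟩ := exists_sepV (e := e) (fun x => ∃ f ∈ F, e f = x) hc
    refine ⟨⟨e q, hV q⟩, ⟨q, rfl⟩, ?_, G, ?_, ?_, ?_⟩
    · rw [← hp]
      exact (memY' _ _).2 hpq
    · rw [finV_iff ho]
      refine (hfin.image e).subset fun x hx => ?_
      exact ((memG x).1 hx).2
    · intro f hf
      obtain ⟨d, hd, hdf⟩ := ((memG f.1).1 hf).2
      rw [← hdf]
      exact hFD hd
    · rintro x ⟨q1, q2, h12, h1, h2⟩
      obtain rfl := he h1
      obtain ⟨f, hf, r, hr, hfr⟩ := hF q2 h12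
      exact ⟨⟨e f, hV f⟩, (memG _).2 ⟨hcar f, f, hf, rfl⟩, ⟨e r, hV r⟩, ⟨q2, r, hr, h2, rfl⟩,
        ⟨f, r, hfr, rfl, rfl⟩⟩

theorem finite_vonNeumann {o : Ordinal.{u}} (ho : o < Ordinal.omega0) :
    (ZFSet.vonNeumann o : Set ZFSet.{u}).Finite := by
  have h : (ZFSet.vonNeumann o).card < Cardinal.aleph0 := by
    rw [ZFSet.card_vonNeumann, ← Cardinal.preBeth_omega]
    exact Cardinal.preBeth_lt_preBeth.2 ho
  rw [← Set.finite_coe_iff, ← Cardinal.lt_aleph0_iff_finite]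
  have h2 := ZFSet.cardinalMk_coe_sort (x := ZFSet.vonNeumann o)
  change Cardinal.mk (ZFSet.vonNeumann o) < _
  rw [h2]
  simpa using h

theorem mem_modelSet {M : posetLanguage.ElementarySubstructure (Vset e o)} {x : ZFSet.{u}} :
    x ∈ modelSet M ↔ ∃ y ∈ M, y.1 = x := by
  rw [modelSet, ZFSet.mem_sep, and_iff_right_iff_imp]
  rintro ⟨y, -, rfl⟩
  exact y.2

/-- Enumerate M and run a fusion with all steps in M, the n-th step treating the n-th element as a
possible name of an ordinal. The bound of the chain is M-generic. Infinitely many conditions force λ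
to be infinite, hence a limit ordinal. -/
theorem IsFusion.isProper [Small.{u} P] [Infinite P] {X : P → P → Prop} (hX : IsFusion X) :
    IsProper.{u} P := by
  intro e he c hpow M hM _ p0 hp0
  have hcar : ∀ q, e q ∈ carrierSet e := fun q => ZFSet.mem_range_self q
  have hc : carrierSet e ∈ ZFSet.vonNeumann c.ord :=
    mem_vonNeumann_of_mem (ZFSet.mem_powerset.2 fun _ h => h) hpow
  have hV : ∀ q, e q ∈ ZFSet.vonNeumann c.ord := fun q => mem_vonNeumann_of_mem (hcar q) hc
  have ho : Order.IsSuccLimit c.ord := by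
    refine Cardinal.isSuccLimit_ord ?_
    by_contra hlt
    have hfin := finite_vonNeumann (o := c.ord)
      (by rwa [← Cardinal.ord_aleph0, Cardinal.ord_lt_ord, ← not_le])
    exact Set.infinite_range_of_injective he (hfin.subset fun x hx => by
      obtain ⟨q, rfl⟩ := hx
      exact hV q)
  obtain ⟨x0, hx0M, hx0⟩ := mem_modelSet.1 hp0
  -- The given `X` need not be in `M`, but by elementarity some fusion relation is.
  obtain ⟨Y, hYM, htr, hchain, hstep⟩ := exists_mem_of_isFO M (φ := fun _ _ _ (Y : Vset e c.ord) => FusionV Y)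
    (IsFO.fusionV (e := e)) hx0M hx0M hx0M (hX.exists_fusionV he ho hc)
  -- the codes of names of ordinals
  let Good : Vset e c.ord → Prop := fun a =>
    ∃ α : Name.{u} P, nameSet e α = a.1 ∧ ∀ p : P, Forces (.isOrdinal α) p
  have step : ∀ (a : M) (x : {x // x ∈ M ∧ CondV x}), ∃ y : {x // x ∈ M ∧ CondV x},
      ZFSet.pair x.1.1 y.1.1 ∈ Y.1 ∧ (Good a.1 → ∃ F ∈ M, FinV F ∧
        (∀ f : Vset e c.ord, f.1 ∈ F.1 → ∃ b, ValueV a.1 b f) ∧ PredenseV F y.1) := by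
    rintro ⟨a, ha⟩ ⟨x, hxM, hx⟩
    -- `Good` speaks of the full forcing relation and is not shown to be definable. It is decided
    -- outside `M`; only the existence of `y` and `F` is reflected.
    by_cases hgood : Good a
    · obtain ⟨α, hα, hord⟩ := hgood
      have h1 : ∃ y : Vset e c.ord, CondV y ∧ ZFSet.pair x.1 y.1 ∈ Y.1 ∧ ∃ F, FinV F ∧
          (∀ f : Vset e c.ord, f.1 ∈ F.1 → ∃ b, ValueV a b f) ∧ PredenseV F y := by
        obtain ⟨D, memD⟩ := exists_sepV (e := e)
          (fun z => ∃ f : Vset e c.ord, f.1 = z ∧ ∃ b, ValueV a b f) hc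
        obtain ⟨y, hy, hxy, F, hF, hFD, hpre⟩ := hstep x hx D (by
          rintro q ⟨p', q', -, -, hq'⟩
          obtain ⟨r, hr, b, hb⟩ := exists_forcesEq_check_toZFSet (hord q')
          have hbV : b.toZFSet ∈ ZFSet.vonNeumann c.ord := by
            rw [check] at hb
            have h2 := rank_le_of_forcesEq (e := e) hb
            rw [show ZFSet.mk (Quotient.out b.toZFSet) = b.toZFSet from Quotient.out_eq _, hα] at h2
            exact ZFSet.mem_vonNeumann.2 (h2.trans_lt (ZFSet.mem_vonNeumann.1 a.2))
          refine ⟨⟨e r, hV r⟩, ⟨q', r, hr, hq', rfl⟩, (memD _).2 ⟨hcar r, ⟨e r, hV r⟩, rfl,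
            ⟨b.toZFSet, hbV⟩, ?_⟩⟩
          exact valueV_of_forcesEq he ho hc hα rfl hb)
        refine ⟨y, hy, hxy, F, hF, fun f hf => ?_, hpre⟩
        obtain ⟨f', hf', h⟩ := ((memD _).1 (hFD f hf)).2
        rwa [Subtype.ext hf'] at h
      obtain ⟨y, hyM, hy, hxy, h2⟩ := exists_mem_of_isFO M (φ := fun (x a Y y : Vset e c.ord) => CondV y ∧
          ZFSet.pair x.1 y.1 ∈ Y.1 ∧ ∃ F, FinV F ∧
          (∀ f : Vset e c.ord, f.1 ∈ F.1 → ∃ b, ValueV a b f) ∧ PredenseV F y)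
        (.and .condV (.and .pair_mem (.ex (.and .finV
          (.and (.all (.imp .mem (.ex .valueV))) .predenseV))))) hxM ha hYM h1
      obtain ⟨F, hFM, h3⟩ := exists_mem_of_isFO M (φ := fun (y a _ F : Vset e c.ord) => FinV F ∧
          (∀ f : Vset e c.ord, f.1 ∈ F.1 → ∃ b, ValueV a b f) ∧ PredenseV F y)
        (.and .finV (.and (.all (.imp .mem (.ex .valueV))) .predenseV)) hyM ha ha h2
      exact ⟨⟨y, hyM, hy⟩, hxy, fun _ => ⟨F, hFM, h3⟩⟩
    · have h1 : ∃ y : Vset e c.ord, CondV y ∧ ZFSet.pair x.1 y.1 ∈ Y.1 := by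
        obtain ⟨y, hy, hxy, -⟩ := hstep x hx ⟨carrierSet e, hc⟩ (by
          rintro q ⟨p', q', -, -, hq'⟩
          exact ⟨q, ⟨q', q', le_rfl, hq', hq'⟩, show q.1 ∈ carrierSet e from hq' ▸ hcar q'⟩)
        exact ⟨y, hy, hxy⟩
      obtain ⟨y, hyM, hy, hxy⟩ := exists_mem_of_isFO M
        (φ := fun (x Y _ y : Vset e c.ord) => CondV y ∧ ZFSet.pair x.1 y.1 ∈ Y.1)
        (.and .condV .pair_mem) hxM hYM hYM h1
      exact ⟨⟨y, hyM, hy⟩, hxy, fun h => absurd h hgood⟩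
  choose g hg hgF using step
  obtain ⟨m, hm⟩ := hM.exists_eq_range ⟨x0, hx0M⟩
  have hmM : ∀ n, m n ∈ M := fun n => by
    rw [← SetLike.mem_coe, hm]
    exact ⟨n, rfl⟩
  let s : ℕ → {x // x ∈ M ∧ CondV x} := fun n =>
    Nat.rec ⟨x0, hx0M, p0, hx0.symm⟩ (fun n x => g ⟨m n, hmM n⟩ x) n
  have hchain' := chain_of_succ (X := fun x y : Vset e c.ord => ZFSet.pair x.1 y.1 ∈ Y.1) htr
    (f := fun n => (s n).1) fun n => hg ⟨m n, hmM n⟩ (s n)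
  -- The chain is built outside `M`, yet it is an element of V_λ, where `FusionV Y` holds for all
  -- sets.
  obtain ⟨C, memC'⟩ := exists_sepV (e := e) (fun z => ∃ n, (s n).1.1 = z) hc
  have memC : ∀ x : Vset e c.ord, x.1 ∈ C.1 ↔ x ∈ Set.range fun n => (s n).1 := by
    intro x
    constructor
    · intro hx
      obtain ⟨n, hn⟩ := ((memC' _).1 hx).2
      exact ⟨n, Subtype.ext hn⟩
    · rintro ⟨n, rfl⟩
      obtain ⟨p, hp⟩ := (s n).2.2
      exact (memC' _).2 ⟨hp ▸ hcar p, n, rfl⟩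
  obtain ⟨z, ⟨q, hqz⟩, hz⟩ := hchain C
    (fun x hx => by
      obtain ⟨n, rfl⟩ := (memC x).1 hx
      exact (s n).2.2)
    (fun x hx y hy => hchain' x ((memC x).1 hx) y ((memC y).1 hy))
  refine ⟨q, (leV_iff he hx0.symm hqz).1 (hz x0 ((memC x0).2 ⟨0, rfl⟩)), ?_⟩
  intro α hα hord
  obtain ⟨a, haM, ha⟩ := mem_modelSet.1 hα
  obtain ⟨n, rfl⟩ : a ∈ Set.range m := hm ▸ haM
  obtain ⟨F, hFM, hFin, hFval, hpre⟩ := hgF ⟨m n, haM⟩ (s n) ⟨α, ha.symm, hord⟩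
  refine forcesMem_check_iff.2 fun q' hq' => ?_
  obtain ⟨x', y', hxy', hx', hy'⟩ := hz (s (n + 1)).1 ((memC _).2 ⟨n + 1, rfl⟩)
  obtain rfl := he (hy'.trans hqz.symm)
  obtain ⟨f, hf, r, ⟨q1, r1, hqr, hq1, hr1⟩, ⟨f1, r2, hfr, hf1, hr2⟩⟩ := hpre ⟨e q', hV q'⟩
    ⟨x', q', hxy'.trans hq', hx', rfl⟩
  obtain rfl := he hq1
  obtain rfl := he (hr1.trans hr2.symm)
  -- Finiteness of `F` is decisive here: it puts `f` into `M`, so a value that `f` decides can be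
  -- found in `M`.
  have hfM : f ∈ M := mem_of_finite M hFM ((finV_iff ho).1 hFin) hf
  obtain ⟨b, hbM, hb⟩ := exists_mem_of_isFO M (φ := fun (a f _ b : Vset e c.ord) => ValueV a b f) .valueV haM hfM hfM
    (hFval f hf)
  exact ⟨r1, hqr, b.1, mem_modelSet.2 ⟨b, hbM, rfl⟩, (hb.forcesEq he hV ha.symm hf1).mono hfr⟩

end Properness

/-! ### Fusion for the tree forcing -/

namespace TreeForcing

variable {X : Type w} {A : ℕ → Set X}

/-- In the tree `T`, above `η`, every value is taken at every coordinate from `n` on. -/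
def Good (A : ℕ → Set X) (T : Set (List X)) (η : List X) (n : ℕ) : Prop :=
  ∀ k, n ≤ k → ∀ x ∈ A k, ∃ ρ ∈ T, η <+: ρ ∧ ρ[k]? = some x

open Classical in
/-- The function `K` of a condition, extended by `0` to all finite sequences. -/
noncomputable def level (p : TreeForcing A) (η : List X) : ℕ :=
  if h : η ∈ p.T then p.K ⟨η, h⟩ else 0

theorem good (p : TreeForcing A) {η : List X} (hη : η ∈ p.T) : Good A p.T η (p.level η) := by
  intro k hk x hx
  rw [level, dif_pos hη] at hk
  exact p.exists_ext ⟨η, hη⟩ k hk x hx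

theorem exists_of_good {T : Set (List X)} (hT : T.Nonempty)
    (hpre : ∀ ρ ∈ T, ∀ η, η <+: ρ → η ∈ T)
    (hA : ∀ η ∈ T, ∀ (l : ℕ) (hl : l < η.length), η[l] ∈ A l) (K : List X → ℕ)
    (hK : ∀ η ∈ T, Good A T η (K η)) :
    ∃ p : TreeForcing A, p.T = T ∧ ∀ η ∈ T, p.level η = K η :=
  ⟨⟨T, fun η => K η, hT, hpre, hA, fun η => hK η.1 η.2⟩, rfl, fun _ hη => dif_pos hη⟩

theorem nil_mem (p : TreeForcing A) : [] ∈ p.T := by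
  obtain ⟨η, hη⟩ := p.nonempty
  exact p.prefix_closed η hη [] List.nil_prefix

/-- Cutting a witness off just after coordinate k bounds its length, so a late enough fusion step
freezes it. -/
theorem Good.exists_short {p : TreeForcing A} {η : List X} {n k : ℕ} (h : Good A p.T η n)
    (hk : n ≤ k) {x : X} (hx : x ∈ A k) :
    ∃ ρ ∈ p.T, η <+: ρ ∧ ρ[k]? = some x ∧ ρ.length ≤ max (k + 1) η.length := by
  obtain ⟨ρ, hρ, hηρ, hkx⟩ := h k hk x hx
  refine ⟨ρ.take (max (k + 1) η.length), p.prefix_closed ρ hρ _ (List.take_prefix _ _),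
    List.prefix_take_iff.2 ⟨hηρ, le_max_right _ _⟩, ?_, List.length_take_le _ _⟩
  rw [List.getElem?_take_of_lt (lt_of_lt_of_le (Nat.lt_succ_self k) (le_max_left _ _)), hkx]

theorem lt_length_of_getElem? {ρ : List X} {k : ℕ} {x : X} (h : ρ[k]? = some x) :
    k < ρ.length :=
  (List.getElem?_eq_some_iff.1 h).1

theorem exists_long (hne : ∀ k, (A k).Nonempty) (p : TreeForcing A) {η : List X}
    (hη : η ∈ p.T) (n : ℕ) : ∃ ρ ∈ p.T, η <+: ρ ∧ n < ρ.length := by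
  obtain ⟨x, hx⟩ := hne (max (p.level η) n)
  obtain ⟨ρ, hρ, h, hk⟩ := p.good hη _ (le_max_left _ _) x hx
  exact ⟨ρ, hρ, h, lt_of_le_of_lt (le_max_right _ _) (lt_length_of_getElem? hk)⟩

theorem getElem?_of_prefix {η ρ : List X} (h : η <+: ρ) {k : ℕ} (hk : k < η.length) :
    ρ[k]? = η[k]? := by
  obtain ⟨t, rfl⟩ := h
  rw [List.getElem?_append_left hk]

/-- The nodes of a condition that are comparable with a given node form a condition. -/
theorem exists_restrict (hne : ∀ k, (A k).Nonempty) (p : TreeForcing A) {ρ : List X}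
    (hρ : ρ ∈ p.T) : ∃ q : TreeForcing A, (∀ ν, ν ∈ q.T ↔ ν ∈ p.T ∧ (ν <+: ρ ∨ ρ <+: ν)) ∧
      ∀ r, q ≤ r → ρ ∈ r.T := by
  obtain ⟨q, hqT, -⟩ := exists_of_good (A := A) (T := {ν | ν ∈ p.T ∧ (ν <+: ρ ∨ ρ <+: ν)})
    ⟨ρ, hρ, Or.inl List.prefix_rfl⟩
    (fun ν hν η hη => ⟨p.prefix_closed ν hν.1 η hη, by
      obtain h | h := hν.2
      · exact Or.inl (hη.trans h)
      · exact List.prefix_or_prefix_of_prefix hη h⟩)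
    -- A node below `ρ` borrows the witnesses of `ρ`, a node above `ρ` uses its own; the maximum
    -- serves both.
    (fun η hη => p.mem_A η hη.1) (fun ν => max (p.level ν) (p.level ρ)) (by
      rintro ν ⟨hν, h | h⟩ k hk x hx
      · obtain ⟨μ, hμ, h', hx'⟩ := p.good hρ k (le_of_max_le_right hk) x hx
        exact ⟨μ, ⟨hμ, Or.inr h'⟩, h.trans h', hx'⟩
      · obtain ⟨μ, hμ, h', hx'⟩ := p.good hν k (le_of_max_le_left hk) x hx
        exact ⟨μ, ⟨hμ, Or.inr (h.trans h')⟩, h', hx'⟩)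
  refine ⟨q, fun ν => by rw [hqT]; rfl, fun r hr => ?_⟩
  -- A node longer than `ρ` and comparable with it must extend it.
  obtain ⟨μ, hμ, -, hlen⟩ := exists_long hne r r.nil_mem ρ.length
  have hμq : μ ∈ q.T := hr hμ
  rw [hqT] at hμq
  obtain h | h := hμq.2
  · exact absurd h.length_le (not_le.2 hlen)
  · exact r.prefix_closed μ hμ ρ h

/-- Above some node, `q'` lies inside a single tree of `G`: otherwise one could leave the trees one
after another, and after finitely many extensions reach a node outside their union. Restricting `q'`
to that node gives the common extension. -/
theorem predenseAbove_of_subset (hne : ∀ k, (A k).Nonempty) {G : Set (TreeForcing A)}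
    (hG : G.Finite) {q : TreeForcing A} (hq : ∀ η ∈ q.T, ∃ g ∈ G, η ∈ g.T) :
    PredenseAbove G q := by
  intro q' hq'
  have key : ∃ ν ∈ q'.T, ∃ g ∈ G, ∀ μ ∈ q'.T, ν <+: μ → μ ∈ g.T := by
    by_contra! hcon
    have h : ∀ G' : Set (TreeForcing A), G'.Finite → G' ⊆ G → ∃ ν ∈ q'.T, ∀ g ∈ G', ν ∉ g.T := by
      intro G' hG'
      induction G', hG' using Set.Finite.induction_on with
      | empty => exact fun _ => ⟨[], q'.nil_mem, by simp⟩
      | @insert g G' _ _ ih =>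
        intro hsub
        obtain ⟨ν, hν, h⟩ := ih ((Set.subset_insert _ _).trans hsub)
        obtain ⟨μ, hμ, hνμ, hμg⟩ := hcon ν hν g (hsub (Set.mem_insert _ _))
        refine ⟨μ, hμ, ?_⟩
        rintro g' (rfl | hg')
        · exact hμg
        · exact fun h' => h g' hg' (g'.prefix_closed μ h' ν hνμ)
    obtain ⟨ν, hν, h⟩ := h G hG subset_rfl
    obtain ⟨g, hg, hνg⟩ := hq ν (hq' hν)
    exact h g hg hνg
  obtain ⟨ν, hν, g, hg, h⟩ := key
  obtain ⟨r, hr, -⟩ := exists_restrict hne q' hν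
  refine ⟨g, hg, r, fun μ hμ => ((hr μ).1 hμ).1, fun μ hμ => ?_⟩
  obtain ⟨hμ, h' | h'⟩ := (hr μ).1 hμ
  · exact g.prefix_closed ν (h ν hν List.prefix_rfl) μ h'
  · exact h μ hμ h'

/-- The fusion relation of the tree forcing. -/
def FusionRel (p q : TreeForcing A) : Prop :=
  q.T ⊆ p.T ∧ p.level [] < q.level [] ∧
    ∀ η ∈ p.T, η ≠ [] → η.length ≤ p.level [] → η ∈ q.T ∧ q.level η = p.level η

/-- The root level only grows, so what `p` has frozen is also frozen by `q`. The root is exempt from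
keeping its level, being the counter. -/
theorem FusionRel.trans {p q r : TreeForcing A} (h : FusionRel p q) (h' : FusionRel q r) :
    FusionRel p r := by
  refine ⟨h'.1.trans h.1, h.2.1.trans h'.2.1, fun η hη h0 hlen => ?_⟩
  obtain ⟨h1, h2⟩ := h.2.2 η hη h0 hlen
  obtain ⟨h3, h4⟩ := h'.2.2 η h1 h0 (hlen.trans h.2.1.le)
  exact ⟨h3, h4.trans h2⟩

theorem FusionRel.exists_bound (hne : ∀ k, (A k).Nonempty) (p₀ : TreeForcing A)
    (C : Set (TreeForcing A))
    (hC : ∀ p ∈ C, ∀ q ∈ C, p = q ∨ FusionRel p q ∨ FusionRel q p) :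
    ∃ q, ∀ p ∈ C, p ≤ q := by
  obtain rfl | hCne := C.eq_empty_or_nonempty
  · exact ⟨p₀, by simp⟩
  have above : ∀ p ∈ C, ∀ q ∈ C, p.level [] < q.level [] → FusionRel p q := by
    intro p hp q hq hlt
    obtain rfl | h | h := hC p hp q hq
    · exact absurd hlt (lt_irrefl _)
    · exact h
    · exact absurd hlt h.2.1.not_gt
  -- A member with the largest counter is itself a bound; otherwise the counters are unbounded and
  -- the trees are intersected.
  by_cases hmax : ∃ p ∈ C, ∀ q ∈ C, q.level [] ≤ p.level []
  · obtain ⟨p, hp, hmax⟩ := hmax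
    refine ⟨p, fun q hq => ?_⟩
    obtain rfl | h | h := hC q hq p hp
    · exact le_rfl
    · exact h.1
    · exact absurd (hmax q hq) (not_le.2 h.2.1)
  push Not at hmax
  have unbdd : ∀ n, ∃ p ∈ C, n ≤ p.level [] := by
    intro n
    induction n with
    | zero => exact hCne.imp fun p hp => ⟨hp, Nat.zero_le _⟩
    | succ n ih =>
      obtain ⟨p, hp, h⟩ := ih
      obtain ⟨q, hq, h'⟩ := hmax p hp
      exact ⟨q, hq, by omega⟩
  let T : Set (List X) := {η | ∀ p ∈ C, η ∈ p.T}
  have memT : ∀ p ∈ C, ∀ η ∈ p.T, η.length ≤ p.level [] → η ∈ T := by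
    intro p hp η hη hlen q hq
    by_cases h0 : η = []
    · exact h0 ▸ q.nil_mem
    obtain rfl | h | h := hC p hp q hq
    · exact hη
    · exact (h.2.2 η hη h0 hlen).1
    · exact h.1 hη
  have good' : ∀ η ∈ T, η ≠ [] → ∃ n, Good A T η n := by
    intro η hη h0
    obtain ⟨p, hp, hlen⟩ := unbdd η.length
    refine ⟨p.level η, fun k hk x hx => ?_⟩
    -- The first bound puts `q` strictly above `p`, so `η` keeps its level; the others let a short
    -- witness in `q` survive in `T`.
    obtain ⟨q, hq, hq'⟩ := unbdd (max (p.level [] + 1) (max (k + 1) η.length))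
    have hpq := above p hp q hq (le_of_max_le_left hq')
    obtain ⟨hηq, hlev⟩ := hpq.2.2 η (hη p hp) h0 hlen
    obtain ⟨ρ, hρ, h1, h2, h3⟩ := (q.good hηq).exists_short (hlev ▸ hk) hx
    exact ⟨ρ, memT q hq ρ hρ (h3.trans (le_of_max_le_right hq')), h1, h2⟩
  have good : ∀ η ∈ T, ∃ n, Good A T η n := by
    intro η hη
    -- The level of the root diverges along the chain, so its witnesses come from a node of length 1
    -- in `T`.
    by_cases h0 : η = []
    · subst h0
      obtain ⟨p, hp, hlen⟩ := unbdd 1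
      obtain ⟨ρ, hρ, -, hρlen⟩ := exists_long hne p p.nil_mem 0
      have h1 : ρ.take 1 ∈ T := memT p hp _ (p.prefix_closed ρ hρ _ (List.take_prefix _ _))
        ((List.length_take_le _ _).trans hlen)
      obtain ⟨n, hn⟩ := good' _ h1 (by
        intro h
        rw [List.take_eq_nil_iff] at h
        obtain h | rfl := h
        · omega
        · simp at hρlen)
      refine ⟨n, fun k hk x hx => ?_⟩
      obtain ⟨μ, hμ, -, hx⟩ := hn k hk x hx
      exact ⟨μ, hμ, List.nil_prefix, hx⟩
    · exact good' η hη h0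
  choose! K hK using good
  obtain ⟨q, hq, -⟩ := exists_of_good (A := A) (T := T) ⟨[], fun p _ => p.nil_mem⟩
    (fun ρ hρ η h p hp => p.prefix_closed ρ (hρ p hp) η h)
    (fun η hη => hCne.some.mem_A η (hη _ hCne.some_mem)) K hK
  exact ⟨q, fun p hp η hη => by
    rw [hq] at hη
    exact hη p hp⟩

theorem finite_short (hfin : ∀ k, (A k).Finite) (p : TreeForcing A) (n : ℕ) :
    {η | η ∈ p.T ∧ η.length ≤ n}.Finite := by
  let U : Set X := ⋃ k ∈ Set.Iio n, A k
  have hU : U.Finite := (Set.finite_Iio n).biUnion fun k _ => hfin k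
  have : Finite U := hU
  refine ((List.finite_length_le U n).image (List.map Subtype.val)).subset ?_
  rintro η ⟨hη, hlen⟩
  have h : η ∈ Set.range (List.map (Subtype.val : U → X)) := by
    rw [Set.range_list_map]
    intro x hx
    obtain ⟨l, hl, rfl⟩ := List.getElem_of_mem hx
    exact ⟨⟨_, Set.mem_biUnion (show l ∈ Set.Iio n from hl.trans_le hlen) (p.mem_A η hη l hl)⟩, rfl⟩
  obtain ⟨ζ, rfl⟩ := h
  exact ⟨ζ, by simpa using hlen, rfl⟩

/-- A union of conditions from D through all short nodes would be enough if levels could grow.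
Keeping the old levels costs finitely many further nodes, each with its own condition from D. -/
theorem FusionRel.exists_step (hfin : ∀ k, (A k).Finite) (hne : ∀ k, (A k).Nonempty)
    (p : TreeForcing A) (D : Set (TreeForcing A)) (hD : DenseAbove D p) :
    ∃ q, FusionRel p q ∧ ∃ F : Set (TreeForcing A), F.Finite ∧ F ⊆ D ∧ PredenseAbove F q := by
  have h1 : ∀ ρ ∈ p.T, ∃ r : TreeForcing A, r.T ⊆ p.T ∧ ρ ∈ r.T ∧ r ∈ D := by
    intro ρ hρ
    obtain ⟨q, hq, hqρ⟩ := exists_restrict hne p hρ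
    have hpq : p ≤ q := fun ν hν => ((hq ν).1 hν).1
    obtain ⟨r, hqr, hr⟩ := hD q hpq
    exact ⟨r, hpq.trans hqr, hqρ r hqr, hr⟩
  have : Nonempty (TreeForcing A) := ⟨p⟩
  choose! r hrp hρr hrD using h1
  have h2 : ∀ η ∈ p.T, ∀ k, p.level η ≤ k → ∀ x ∈ A k,
      ∃ ρ ∈ p.T, η <+: ρ ∧ ρ[k]? = some x := fun η hη k hk x hx => p.good hη k hk x hx
  choose! e heT hepre hex using h2
  let N := p.level []
  let S : Set (List X) := {η | η ∈ p.T ∧ η.length ≤ N}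
  have hS : S.Finite := finite_short hfin p N
  -- The added nodes are the witnesses that `p` has above `η` at coordinates where `r η` need not
  -- have any yet.
  let S' : Set (List X) := S ∪ ⋃ η ∈ S, ⋃ k ∈ Set.Ico (p.level η) ((r η).level η),
    (fun x => e η k x) '' A k
  have hS' : S'.Finite := hS.union (hS.biUnion fun η _ =>
    (Set.finite_Ico _ _).biUnion fun k _ => (hfin k).image _)
  have hS'p : ∀ ρ ∈ S', ρ ∈ p.T := by
    rintro ρ (hρ | hρ)
    · exact hρ.1
    · simp only [Set.mem_iUnion] at hρ
      obtain ⟨η, hη, k, hk, x, hx, rfl⟩ := hρ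
      exact heT η hη.1 k hk.1 x hx
  let G : Set (TreeForcing A) := r '' S'
  have hGfin : G.Finite := hS'.image r
  have hGD : G ⊆ D := by
    rintro _ ⟨ρ, hρ, rfl⟩
    exact hrD ρ (hS'p ρ hρ)
  let T : Set (List X) := {η | ∃ g ∈ G, η ∈ g.T}
  have hTp : T ⊆ p.T := by
    rintro η ⟨_, ⟨ρ, hρ, rfl⟩, hη⟩
    exact hrp ρ (hS'p ρ hρ) hη
  have hS'T : ∀ ρ ∈ S', ρ ∈ T := fun ρ hρ => ⟨r ρ, ⟨ρ, hρ, rfl⟩, hρr ρ (hS'p ρ hρ)⟩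
  have hgood : ∀ η ∈ T, ∃ n, Good A T η n := by
    rintro η ⟨g, hg, hη⟩
    refine ⟨g.level η, fun k hk x hx => ?_⟩
    obtain ⟨ρ, hρ, h⟩ := g.good hη k hk x hx
    exact ⟨ρ, ⟨g, hg, hρ⟩, h⟩
  have hgoodS : ∀ η ∈ S, Good A T η (p.level η) := by
    intro η hη k hk x hx
    by_cases hk' : (r η).level η ≤ k
    · obtain ⟨ρ, hρ, h⟩ := (r η).good (hρr η hη.1) k hk' x hx
      exact ⟨ρ, ⟨r η, ⟨η, Or.inl hη, rfl⟩, hρ⟩, h⟩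
    · refine ⟨e η k x, hS'T _ (Or.inr ?_), hepre η hη.1 k hk x hx, hex η hη.1 k hk x hx⟩
      simp only [Set.mem_iUnion]
      exact ⟨η, hη, k, ⟨hk, not_le.1 hk'⟩, x, hx, rfl⟩
  choose! K hK using hgood
  classical
  have hnilS : [] ∈ S := ⟨p.nil_mem, Nat.zero_le _⟩
  obtain ⟨q, hqT, hqK⟩ := exists_of_good (A := A) (T := T) ⟨[], hS'T [] (Or.inl hnilS)⟩
    (fun ρ ⟨g, hg, hρ⟩ η h => ⟨g, hg, g.prefix_closed ρ hρ η h⟩)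
    (fun η hη => p.mem_A η (hTp hη))
    -- N + 1 makes the counter strictly larger; the short nodes retain their old level.
    (fun η => if η = [] then max (K []) (N + 1) else if η ∈ S then p.level η else K η) (by
      intro η hη
      split_ifs with h0 hS
      · subst h0
        exact fun k hk => hK [] hη k (le_of_max_le_left hk)
      · exact hgoodS η hS
      · exact hK η hη)
  refine ⟨q, ⟨hqT ▸ hTp, ?_, fun η hη h0 hlen => ?_⟩, G, hGfin, hGD,
    predenseAbove_of_subset hne hGfin fun η hη => by rwa [hqT] at hη⟩
  · rw [hqK [] (hS'T [] (Or.inl hnilS)), if_pos rfl]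
    exact lt_of_lt_of_le (Nat.lt_succ_self N) (le_max_right _ _)
  · have hηS : η ∈ S := ⟨hη, hlen⟩
    have hηT := hS'T η (Or.inl hηS)
    exact ⟨hqT ▸ hηT, by rw [hqK η hηT, if_neg h0, if_pos hηS]⟩

theorem isFusion (hfin : ∀ k, (A k).Finite) (hne : ∀ k, (A k).Nonempty) (p₀ : TreeForcing A) :
    IsFusion (FusionRel (A := A)) where
  le _ _ h := h.1
  trans _ _ _ h h' := h.trans h'
  chain := FusionRel.exists_bound hne p₀
  step := FusionRel.exists_step hfin hne

/-- The full tree is a condition, with a function `K` that may be taken arbitrarily large. -/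
theorem exists_full (hne : ∀ k, (A k).Nonempty) (n : ℕ) :
    ∃ p : TreeForcing A, p.level [] = n := by
  let T : Set (List X) := {η | ∀ (l : ℕ) (hl : l < η.length), η[l] ∈ A l}
  have snoc : ∀ η ∈ T, ∀ x ∈ A η.length, η ++ [x] ∈ T := by
    intro η hη x hx l hl
    rw [List.getElem_append]
    split_ifs with h
    · exact hη l h
    · have : l = η.length := by
        rw [List.length_append, List.length_singleton] at hl
        omega
      subst this
      simpa using hx
  have long : ∀ η ∈ T, ∀ k, ∃ ρ ∈ T, η <+: ρ ∧ ρ.length = η.length + k := by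
    intro η hη k
    induction k with
    | zero => exact ⟨η, hη, List.prefix_rfl, rfl⟩
    | succ k ih =>
      obtain ⟨ρ, hρ, h, hlen⟩ := ih
      obtain ⟨x, hx⟩ := hne ρ.length
      exact ⟨ρ ++ [x], snoc ρ hρ x hx, h.trans (List.prefix_append _ _), by
        rw [List.length_append, hlen]; rfl⟩
  obtain ⟨p, -, hp⟩ := exists_of_good (A := A) (T := T) ⟨[], fun l hl => by simp at hl⟩
    (fun ρ hρ η h l hl => by
      rw [h.getElem hl]
      exact hρ l _)
    -- From its length on, a node can be extended to length exactly k and then by any value; adding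
    -- n only raises the level.
    (fun η hη => hη) (fun η => η.length + n) (by
      intro η hη k hk x hx
      obtain ⟨ρ, hρ, h, hlen⟩ := long η hη (k - η.length)
      have hk' : ρ.length = k := by omega
      refine ⟨ρ ++ [x], snoc ρ hρ x (hk' ▸ hx), h.trans (List.prefix_append _ _), ?_⟩
      rw [← hk', List.getElem?_concat_length])
  exact ⟨p, (hp [] fun l hl => by simp at hl).trans (by simp)⟩

/-- Conditions with the same tree but different K are distinct, so this holds even if every A_k is a
singleton. -/
theorem infinite (hne : ∀ k, (A k).Nonempty) : Infinite (TreeForcing A) := by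
  choose f hf using exists_full hne
  exact Infinite.of_injective f fun m n h => by rw [← hf m, h, hf n]

/-- The condition `p` decides the coordinate `k` of the generic sequence to be `x`. -/
def Decides (p : TreeForcing A) (k : ℕ) (x : X) : Prop :=
  ∀ ρ ∈ p.T, ∀ y, ρ[k]? = some y → y = x

theorem Decides.mono {p q : TreeForcing A} {k : ℕ} {x : X} (h : Decides p k x) (hpq : p ≤ q) :
    Decides q k x :=
  fun ρ hρ => h ρ (hpq hρ)

theorem Decides.mem (hne : ∀ k, (A k).Nonempty) {p : TreeForcing A} {k : ℕ} {x : X}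
    (h : Decides p k x) : x ∈ A k := by
  obtain ⟨ρ, hρ, -, hk⟩ := exists_long hne p p.nil_mem k
  rw [← h ρ hρ _ (List.getElem?_eq_getElem hk)]
  exact p.mem_A ρ hρ k hk

theorem Decides.unique (hne : ∀ k, (A k).Nonempty) {p : TreeForcing A} {k : ℕ} {x y : X}
    (h : Decides p k x) (h' : Decides p k y) : x = y := by
  obtain ⟨ρ, hρ, -, hk⟩ := exists_long hne p p.nil_mem k
  rw [← h ρ hρ _ (List.getElem?_eq_getElem hk), h' ρ hρ _ (List.getElem?_eq_getElem hk)]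

theorem exists_decides_of_mem (hne : ∀ k, (A k).Nonempty) (p : TreeForcing A) {ρ : List X}
    (hρ : ρ ∈ p.T) {k : ℕ} {x : X} (h : ρ[k]? = some x) : ∃ q, p ≤ q ∧ Decides q k x := by
  obtain ⟨q, hq, -⟩ := exists_restrict hne p hρ
  refine ⟨q, fun ν hν => ((hq ν).1 hν).1, fun ν hν y hy => ?_⟩
  obtain h' | h' := ((hq ν).1 hν).2
  · rw [← getElem?_of_prefix h' (lt_length_of_getElem? hy), h] at hy
    exact (Option.some.inj hy).symm
  · rw [getElem?_of_prefix h' (lt_length_of_getElem? h), h] at hy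
    exact (Option.some.inj hy).symm

theorem exists_decides (hne : ∀ k, (A k).Nonempty) (p : TreeForcing A) (k : ℕ) :
    ∃ q, p ≤ q ∧ ∃ x, Decides q k x := by
  obtain ⟨ρ, hρ, -, hk⟩ := exists_long hne p p.nil_mem k
  obtain ⟨q, hq, h⟩ := exists_decides_of_mem hne p hρ (List.getElem?_eq_getElem hk)
  exact ⟨q, hq, _, h⟩

theorem exists_decides_eq (hne : ∀ k, (A k).Nonempty) (p : TreeForcing A) {f : ℕ → X}
    (hf : ∀ k, f k ∈ A k) {B : Set ℕ} (hB : B.Infinite) (m : ℕ) :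
    ∃ q, p ≤ q ∧ ∃ n ∈ B, m < n ∧ Decides q n (f n) := by
  obtain ⟨n, hn, hlt⟩ := hB.exists_gt (max m (p.level []))
  obtain ⟨ρ, hρ, -, h⟩ := p.good p.nil_mem n (le_of_max_le_right hlt.le) (f n) (hf n)
  obtain ⟨q, hq, h'⟩ := exists_decides_of_mem hne p hρ h
  exact ⟨q, hq, n, hn, lt_of_le_of_lt (le_max_left _ _) hlt, h'⟩

end TreeForcing

/-! ### Names of functions on ω: ground model sequences and the generic sequence -/

section Functions

variable {P : Type v} [Preorder P] [Small.{u} P]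

/-- The name `f` is a name of a function with domain `ω`, and `R p k x` says that `p` decides its
value at `k` to be the ground model set `x`. -/
structure NamesFunction (f : Name.{u} P) (R : P → ℕ → ZFSet.{u} → Prop) : Prop where
  mem_iff : ∀ σ p, ForcesMem σ f p ↔ ∀ q, p ≤ q → ∃ r, q ≤ r ∧ ∃ k x, R r k x ∧
    ForcesEq σ (check P (ZFSet.pair (natSet k) x)) r
  mono : ∀ p q k x, p ≤ q → R p k x → R q k x
  unique : ∀ p k x y, R p k x → R p k y → x = y
  total : ∀ p k, ∃ r, p ≤ r ∧ ∃ x, R r k x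

namespace NamesFunction

variable {f : Name.{u} P} {R : P → ℕ → ZFSet.{u} → Prop}

theorem forces_pairMem (h : NamesFunction f R) {σ τ : Name.{u} P} {p : P} {k : ℕ} {x : ZFSet.{u}}
    (hR : R p k x) (hσ : ForcesEq σ (check P (natSet k)) p) (hτ : ForcesEq τ (check P x) p) :
    Forces (.pairMem σ τ f) p := by
  rw [forces_pairMem_iff, h.mem_iff]
  intro q hq
  refine ⟨q, le_rfl, k, x, h.mono _ _ _ _ hq hR, ?_⟩
  exact (pairName_congr (hσ.mono hq) (hτ.mono hq)).trans (pairName_check _ _ _)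

theorem exists_of_pairMem (h : NamesFunction f R) {σ τ : Name.{u} P} {p : P}
    (hf : Forces (.pairMem σ τ f) p) : ∃ r, p ≤ r ∧ ∃ k x, R r k x ∧
      ForcesEq σ (check P (natSet k)) r ∧ ForcesEq τ (check P x) r := by
  rw [forces_pairMem_iff, h.mem_iff] at hf
  obtain ⟨r, hr, k, x, hR, e⟩ := hf p le_rfl
  exact ⟨r, hr, k, x, hR, pairName_eq_check_pair e⟩

theorem isFunOn (h : NamesFunction f R) (p : P) :
    Forces (.isFunOn f (check P ZFSet.omega.{u})) p := by
  refine ⟨fun z q _ hz q' hq' => ?_, fun σ q _ hσ => ⟨fun q' hq' => ?_, ?_⟩⟩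
  · obtain ⟨r, hr, k, x, -, e⟩ := (h.mem_iff z q).1 hz q' hq'
    refine ⟨r, hr, check P (natSet k), forcesMem_check_check_iff.2 (mem_omega_iff.2 ⟨k, rfl⟩),
      forces_ex_of (check P x) ?_⟩
    exact forces_isPair_iff.2 (e.trans (pairName_check _ _ _).symm)
  · obtain ⟨r, hr, k, e⟩ := exists_natSet_of_mem_omega (ForcesMem.mono hσ hq')
    obtain ⟨r', hr', x, hx⟩ := h.total r k
    exact ⟨r', hr.trans hr', check P x, h.forces_pairMem hx (e.mono hr') (ForcesEq.refl _ _)⟩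
  · intro y y' q1 _ hy q2 hq2 hy'
    refine Forces.of_dense fun q3 hq3 => ?_
    obtain ⟨r, hr, k, x, hR, e1, e2⟩ := h.exists_of_pairMem (hy.mono (hq2.trans hq3))
    obtain ⟨r', hr', k', x', hR', e1', e2'⟩ := h.exists_of_pairMem (hy'.mono (hq3.trans hr))
    obtain rfl := natSet_injective (forcesEq_check_iff.1 ((e1.mono hr').symm.trans e1'))
    obtain rfl := h.unique r' k x x' (h.mono _ _ _ _ hr' hR) hR'
    exact ⟨r', hr.trans hr', (e2.mono hr').trans e2'.symm⟩

end NamesFunction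

theorem namesFunction_check_seqSet (f : ℕ → ZFSet.{u}) :
    NamesFunction (check P (seqSet f)) fun _ k x => x = f k where
  mem_iff σ p := by
    rw [forcesMem_check_iff]
    refine forall₂_congr fun q _ => exists_congr fun r => and_congr_right fun _ => ?_
    constructor
    · rintro ⟨y, hy, e⟩
      obtain ⟨k, rfl⟩ := mem_seqSet.1 hy
      exact ⟨k, _, rfl, e⟩
    · rintro ⟨k, _, rfl, e⟩
      exact ⟨_, mem_seqSet.2 ⟨k, rfl⟩, e⟩
  mono _ _ _ _ _ h := h
  unique _ _ _ _ h h' := h.trans h'.symm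
  total p k := ⟨p, le_rfl, _, rfl⟩

theorem NamesFunction.isChoiceFun {f : Name.{u} P} {R : P → ℕ → ZFSet.{u} → Prop}
    (h : NamesFunction f R) {S : ℕ → ZFSet.{u}} (hS : ∀ p k x, R p k x → x ∈ S k) (p : P) :
    Forces (.isChoiceFun f (check P (seqSet S)) (check P ZFSet.omega.{u})) p := by
  have hS' := namesFunction_check_seqSet (P := P) S
  refine ⟨⟨h.isFunOn p, hS'.isFunOn p⟩, ?_⟩
  intro σ q _ _ y a q1 _ hy q2 hq2 ha
  refine Forces.of_dense fun q3 hq3 => ?_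
  obtain ⟨r, hr, k, x, hR, e1, e2⟩ := h.exists_of_pairMem (hy.mono (hq2.trans hq3))
  obtain ⟨r', hr', k', x', rfl, e1', e2'⟩ := hS'.exists_of_pairMem (ha.mono (hq3.trans hr))
  obtain rfl := natSet_injective (forcesEq_check_iff.1 ((e1.mono hr').symm.trans e1'))
  exact ⟨r', hr.trans hr', ((forcesMem_check_check_iff.2 (hS _ _ _ hR)).congr_left
    (e2.mono hr').symm).congr_right e2'.symm⟩

theorem NamesFunction.agreeInfinitely {f : Name.{u} P} {R : P → ℕ → ZFSet.{u} → Prop}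
    (h : NamesFunction f R) {g : ℕ → ZFSet.{u}} {B : Set ℕ}
    (hB : ∀ p m, ∃ q, p ≤ q ∧ ∃ n ∈ B, m < n ∧ R q n (g n)) (p : P) :
    Forces (agreeInfinitely f (check P (seqSet g)) (check P (subsetOmega B))) p := by
  intro σ q _ hσ q' hq'
  obtain ⟨r, hr, m, e⟩ := exists_natSet_of_mem_omega (ForcesMem.mono hσ hq')
  obtain ⟨r', hr', n, hn, hmn, hR⟩ := hB r m
  refine ⟨r', hr.trans hr', check P (natSet n), ?_, ?_, forces_ex_of (check P (g n)) ⟨?_, ?_⟩⟩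
  · exact forcesMem_check_check_iff.2 (ZFSet.mem_range.2 ⟨⟨n, hn⟩, rfl⟩)
  · exact (forcesMem_check_check_iff.2 (natSet_mem_natSet hmn)).congr_left (e.mono hr').symm
  · exact h.forces_pairMem hR (ForcesEq.refl _ _) (ForcesEq.refl _ _)
  · exact (namesFunction_check_seqSet g).forces_pairMem rfl (ForcesEq.refl _ _) (ForcesEq.refl _ _)

end Functions

/-- The name of the generic sequence of the tree forcing. -/
noncomputable def genericName (A : ℕ → ZFSet.{u}) : Name.{u} (Q A) :=
  Name.mk {z : Shrink.{u} (Q A) × ULift.{u} ℕ //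
      ∃ x, TreeForcing.Decides ((equivShrink (Q A)).symm z.1) z.2.down x}
    (fun i => check (Q A) (ZFSet.pair (natSet i.1.2.down) i.2.choose))
    (fun i => (equivShrink (Q A)).symm i.1.1)

theorem namesFunction_genericName {A : ℕ → ZFSet.{u}}
    (hne : ∀ k, (A k : Set ZFSet.{u}).Nonempty) :
    NamesFunction (genericName A) fun (p : Q A) k x => TreeForcing.Decides p k x where
  mem_iff σ p := by
    rw [genericName, forcesMem_mk]
    refine forall₂_congr fun q _ => exists_congr fun r => and_congr_right fun _ => ?_
    constructor
    · rintro ⟨i, hi, e⟩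
      exact ⟨_, _, i.2.choose_spec.mono hi, e⟩
    · rintro ⟨k, x, hx, e⟩
      have hex : ∃ x, TreeForcing.Decides
          ((equivShrink (Q A)).symm (equivShrink (Q A) r)) k x := ⟨x, by simpa using hx⟩
      -- The value chosen in the name is the only one that the condition can decide, since its tree
      -- has nodes reaching coordinate k.
      have hch : hex.choose = x :=
        TreeForcing.Decides.unique hne (by simpa using hex.choose_spec) hx
      refine ⟨⟨(equivShrink (Q A) r, ⟨k⟩), hex⟩, by simp, ?_⟩
      dsimp only
      rwa [hch]
  mono _ _ _ _ hpq h := h.mono hpq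
  unique _ _ _ _ h h' := h.unique hne h'
  total p k := TreeForcing.exists_decides hne p k

end SetForcing

open SetForcing in
theorem proposition1p10 (A : ℕ → ZFSet.{u}) (hfin : ∀ k, (A k : Set ZFSet.{u}).Finite)
    (hne : ∀ k, (A k : Set ZFSet.{u}).Nonempty) :
    Nonempty (Q A) ∧ IsOmegaOmegaBounding.{u} (Q A) ∧ IsProper.{u} (Q A) ∧
    ∃ η : Name.{u} (Q A),
      (∀ p : Q A, Forces
        (.isChoiceFun η (check (Q A) (seqSet A)) (check (Q A) ZFSet.omega.{u})) p) ∧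
      ∀ f : ℕ → ZFSet.{u}, (∀ k, f k ∈ A k) → ∀ B : Set ℕ, B.Infinite →
        ∀ p : Q A, Forces
          (agreeInfinitely η (check (Q A) (seqSet f)) (check (Q A) (subsetOmega B))) p := by
  obtain ⟨p₀, -⟩ := TreeForcing.exists_full hne 0
  have hfus := TreeForcing.isFusion hfin hne p₀
  have : Infinite (Q A) := TreeForcing.infinite hne
  have hη := namesFunction_genericName hne
  refine ⟨⟨p₀⟩, hfus.isOmegaOmegaBounding, hfus.isProper, genericName A,
    hη.isChoiceFun fun p k x h => TreeForcing.Decides.mem hne h, fun f hf B hB => ?_⟩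
  exact hη.agreeInfinitely fun p m => TreeForcing.exists_decides_eq hne p hf hB m
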